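/- Let $V$ be a finite set and let $(Y_k)_{k\in V}$ be real random variables on a common probability space. Assume that the family has a dependency graph of maximal degree $D\in\mathbb Z_{\ge0}$: a multigraph on $V$ (multiple edges and loops allowed; the degree of a vertex is the number of edges containing it) such that, whenever $V_1,V_2\subset V$ are disjoint and no edge has one endpoint in $V_1$ and the other in $V_2$, the families $(Y_k)_{k\in V_1}$ and $(Y_k)_{k\in V_2}$ are independent. Let $S=\sum_{k\in V}Y_k$, $v=\sqrt{\operatorname{Var}[S]}$, $W=(S-\mathbb E[S])/v$ and $\rho=|\mathbb E[(S-\mathbb E[S])^3]|$. Fix real numbers $(c_k)_{k\in V}$ and put $\mathcal A_\delta=\sum_{k\in V}\mathbb E[|Y_k-c_k|^\delta]$. Assume that $v>0$ and that $\max_{k\in V}\|Y_k-c_k\|_\infty\le L$ for some $L\in(0,\infty)$. Let $d_{\mathrm{Kol}}(W,\mathcal N(0,1))=\sup_{t\in\mathbb R}|\mathbb P(W\le t)-\mathbb P(Z\le t)|$ with $Z\sim\mathcal N(0,1)$, and define $$B_1=\max\left\{68.5\,\frac{(D+1)^2\mathcal A_3}{v^3},\ 22.88\,\frac{L(D+1)}{v}\right\},$$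 $$B_2=0.607148\,\frac{\rho}{v^3}+116.84\,\frac{(D+1)^3\mathcal A_4}{v^4}+\max\left\{16.57\,\frac{L(D+1)}{v},\ 22.47\sqrt{\frac{(D+1)^3\mathcal A_4}{v^4}}+1.596\,\frac{\rho}{v^3}\right\}.$$ Then $$d_{\mathrm{Kol}}(W,\mathcal N(0,1))\le B_2 .$$ Moreover, if $B_1<1$, then $B_2<1.06164\,B_1$; and if in addition $c_k=\mathbb E[Y_k]$ for every $k\in V$, then $B_2<0.85771\,B_1$. -/

import Mathlib

open MeasureTheory ProbabilityTheory

namespace DepGraph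

/-- A finite multigraph on the vertex set `V`: the multiset of its edges, each of which is an
unordered pair of vertices. Multiple edges and loops are allowed; a simple graph is the special
case of a duplicate-free multiset without diagonal elements. -/
abbrev Multigraph (V : Type*) := Multiset (Sym2 V)

open Classical in
/-- The degree of the vertex `k`: the number of edges (with multiplicity) that `k` belongs to. -/
noncomputable def degree {V : Type*} (G : Multigraph V) (k : V) : ℕ :=
  Multiset.card (Multiset.filter (fun e : Sym2 V => k ∈ e) G)

/-- The maximal degree of a multigraph on a finite vertex set. -/
noncomputable def maxDegree {V : Type*} [Fintype V] (G : Multigraph V) : ℕ :=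
  Finset.univ.sup (degree G)

/-- `G` is a dependency graph of the family `Y`: whenever `A` and `B` are disjoint sets of
vertices with no edge between them, the families `(Y k)_{k ∈ A}` and `(Y k)_{k ∈ B}` are
independent. -/
def IsDependencyGraph {V Ω : Type*} [MeasurableSpace Ω] (P : Measure Ω) (Y : V → Ω → ℝ)
    (G : Multigraph V) : Prop :=
  ∀ A B : Set V, Disjoint A B → (∀ a ∈ A, ∀ b ∈ B, s(a, b) ∉ G) →
    IndepFun (fun ω (k : A) => Y k ω) (fun ω (k : B) => Y k ω) P

/-- The Kolmogorov distance between two (probability) measures on the real line. -/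
noncomputable def dKol (μ ν : Measure ℝ) : ℝ :=
  ⨆ t : ℝ, |μ.real (Set.Iic t) - ν.real (Set.Iic t)|

section Family

variable {V Ω : Type*} [Fintype V] [MeasurableSpace Ω]

/-- The sum `S = ∑ k, Y k`. -/
noncomputable def sumRV (Y : V → Ω → ℝ) (ω : Ω) : ℝ := ∑ k, Y k ω

/-- The standard deviation `v` of `S`. -/
noncomputable def stdDev (P : Measure Ω) (Y : V → Ω → ℝ) : ℝ :=
  Real.sqrt (variance (sumRV Y) P)

/-- The normalized sum `W = (S - E[S]) / v`. -/
noncomputable def normalizedSum (P : Measure Ω) (Y : V → Ω → ℝ) (ω : Ω) : ℝ :=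
  (sumRV Y ω - ∫ ω', sumRV Y ω' ∂P) / stdDev P Y

/-- `A_δ = ∑ k, E[|Y k - c k| ^ δ]`. -/
noncomputable def absMomentSum (P : Measure Ω) (Y : V → Ω → ℝ) (c : V → ℝ) (δ : ℝ) : ℝ :=
  ∑ k, ∫ ω, |Y k ω - c k| ^ δ ∂P

/-- `ρ = |E[(S - E[S]) ^ 3]|`. -/
noncomputable def rho (P : Measure Ω) (Y : V → Ω → ℝ) : ℝ :=
  |∫ ω, (sumRV Y ω - ∫ ω', sumRV Y ω' ∂P) ^ 3 ∂P|

/-- The bound `max {68.5 (D+1)² A₃ / v³, 22.88 L (D+1) / v}`. -/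
noncomputable def simpleBound (P : Measure Ω) (Y : V → Ω → ℝ) (c : V → ℝ) (L : ℝ) (D : ℕ) : ℝ :=
  max (68.5 * (((D : ℝ) + 1) ^ 2 * absMomentSum P Y c 3 / stdDev P Y ^ 3))
    (22.88 * (L * ((D : ℝ) + 1) / stdDev P Y))

/-- The bound `0.607148 ρ/v³ + 116.84 (D+1)³ A₄ / v⁴ +
max {16.57 L (D+1) / v, 22.47 √((D+1)³ A₄ / v⁴) + 1.596 ρ/v³}`. -/
noncomputable def refinedBound (P : Measure Ω) (Y : V → Ω → ℝ) (c : V → ℝ) (L : ℝ) (D : ℕ) : ℝ :=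
  0.607148 * (rho P Y / stdDev P Y ^ 3)
    + 116.84 * (((D : ℝ) + 1) ^ 3 * absMomentSum P Y c 4 / stdDev P Y ^ 4)
    + max (16.57 * (L * ((D : ℝ) + 1) / stdDev P Y))
        (22.47 * Real.sqrt (((D : ℝ) + 1) ^ 3 * absMomentSum P Y c 4 / stdDev P Y ^ 4)
          + 1.596 * (rho P Y / stdDev P Y ^ 3))

end Family

end DepGraph

/-!
The proof compares characteristic functions. Subtracting the constants `c k` changes neither the
dependency graph nor the normalized sum, so the variables `X k = Y k - c k` may be used.

*Cumulants.* The joint cumulant of `X (k 0), …, X (k n)` vanishes when the graph induced on the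
positions is disconnected. Unfolding it along an edge from a merged block `g` to a vertex `j` either
merges `j` into `g` or splits the cumulant in two (`mergedCumulant_insert`); the forests rooted in
`g` obey the matching recursion (`forestSum_insert_le`), which bounds the joint cumulant by `2 ^ n`
times the number of spanning trees times a product of norms (`abs_mergedCumulant_le`). A joint
cumulant does not depend on the root, and so the arithmetic-geometric mean inequality reduces the
sum over all labelings to counting labelled trees, `(n + 1) ^ (n - 1)` in number, each of which is
embedded in at most `(D + 1) ^ n` ways from its root (`labelSum_forestSum_le`). Hence the cumulant
of order `n + 1` of the sum is at most
`2 ^ n (n + 1) ^ (n - 1) (D + 1) ^ n A_{n + 1}` (`abs_cumulantSucc_le`).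

*Characteristic function.* By this bound the cumulant series converges for `2 e L (D + 1) |z| < 1`.
There its exponential is the moment generating function
(`integral_exp_eq_exp_cumulant_series`), because both solve the same differential equation. The
terms of order one and two give the Gaussian factor, the third cumulant is the third central moment,
and Stirling's formula sums the rest to at most `19.5 (D + 1)³ A₄ |z| ^ 4`
(`exists_charFun_eq_exp`).

*Smoothing.* The distribution functions are compared after convolution with the Fejér kernel, whose
Fourier transform is a triangle on `[-T, T]`: `dKol_le_of_norm_charFun_sub_le`. On that interval the
exponent of the error factor is at most `0.36 t ^ 2`, and convexity of the exponential leaves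
explicit Gaussian integrals (`dKol_gaussianReal_le_of_charFun`).

*Comparison of the bounds.* The cumulant bound of order three gives `ρ ≤ 12 (D + 1)² A₃`. For
centred variables third cumulants are plain moments, which improves `12` to `3`. Together with
`A₄ ≤ L A₃` the rest is arithmetic (`refined_lt_simple`).
-/

namespace DepGraph

/-! ### Joint cumulants attached to a set function -/

section SubsetSums

variable {ι R : Type*} [DecidableEq ι]

theorem sum_powerset_sdiff [AddCommMonoid R] (f : Finset ι → Finset ι → Finset ι → R)
    (B : Finset ι) :
    ∑ J ∈ B.powerset, ∑ C ∈ (B \ J).powerset, f J C ((B \ J) \ C)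
      = ∑ D ∈ B.powerset, ∑ J ∈ D.powerset, f J (D \ J) (B \ D) := by
  rw [Finset.sum_sigma', Finset.sum_sigma']
  refine Finset.sum_bij' (fun x _ => ⟨x.1 ∪ x.2, x.1⟩) (fun x _ => ⟨x.2, x.1 \ x.2⟩) ?_ ?_ ?_ ?_ ?_
  · rintro ⟨J, C⟩ h
    simp only [Finset.mem_sigma, Finset.mem_powerset] at h ⊢
    grind
  · rintro ⟨J, C⟩ h
    simp only [Finset.mem_sigma, Finset.mem_powerset] at h ⊢
    grind
  · rintro ⟨J, C⟩ h
    simp only [Finset.mem_sigma, Finset.mem_powerset] at h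
    have : (J ∪ C) \ J = C := by grind
    simp [this]
  · rintro ⟨J, C⟩ h
    simp only [Finset.mem_sigma, Finset.mem_powerset] at h
    have : C ∪ J \ C = J := by grind
    simp [this]
  · rintro ⟨J, C⟩ h
    simp only [Finset.mem_sigma, Finset.mem_powerset] at h
    have h1 : (J ∪ C) \ J = C := by grind
    have h2 : B \ (J ∪ C) = (B \ J) \ C := by grind
    simp [h1, h2]

theorem sum_powerset_comm [AddCommMonoid R] (f : Finset ι → Finset ι → R) (B : Finset ι) :
    ∑ C ∈ B.powerset, f C (B \ C) = ∑ C ∈ B.powerset, f (B \ C) C := by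
  refine Finset.sum_bij' (fun C _ => B \ C) (fun C _ => B \ C) ?_ ?_ ?_ ?_ ?_
  all_goals intro C hC
  all_goals simp only [Finset.mem_powerset] at hC ⊢
  · exact Finset.sdiff_subset
  · exact Finset.sdiff_subset
  · exact Finset.sdiff_sdiff_eq_self hC
  · exact Finset.sdiff_sdiff_eq_self hC
  · rw [Finset.sdiff_sdiff_eq_self hC]

theorem sum_powerset_four [AddCommMonoid R]
    (f : Finset ι → Finset ι → Finset ι → Finset ι → R) (B : Finset ι) :
    ∑ J ∈ B.powerset, ∑ K ∈ J.powerset, ∑ C ∈ (B \ J).powerset, f K (J \ K) C ((B \ J) \ C)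
      = ∑ D ∈ B.powerset, ∑ K ∈ D.powerset, ∑ K' ∈ (B \ D).powerset,
          f K K' (D \ K) ((B \ D) \ K') := by
  simp_rw [Finset.sum_sigma']
  refine Finset.sum_bij' (fun x _ => ⟨x.2.1 ∪ x.2.2, x.2.1, x.1 \ x.2.1⟩)
    (fun x _ => ⟨x.2.1 ∪ x.2.2, x.2.1, x.1 \ x.2.1⟩) ?_ ?_ ?_ ?_ ?_
  all_goals rintro ⟨J, K, C⟩ h
  all_goals simp only [Finset.mem_sigma, Finset.mem_powerset] at h ⊢
  · grind
  · grind
  · have h1 : K ∪ J \ K = J := by grind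
    have h2 : (K ∪ C) \ K = C := by grind
    simp [h1, h2]
  · have h1 : K ∪ J \ K = J := by grind
    have h2 : (K ∪ C) \ K = C := by grind
    simp [h1, h2]
  · have h1 : (K ∪ C) \ K = C := by grind
    have h2 : (B \ (K ∪ C)) \ (J \ K) = (B \ J) \ C := by grind
    simp [h1, h2]

end SubsetSums

section Cumulant

variable {ι R : Type*} [DecidableEq ι] [CommRing R]

/-- The joint cumulant of a merged block `g` and the individual elements of `B`, with respect to
the "moments" `M`: if `M U = E[∏ i ∈ U, X i]`, this is the joint cumulant of the variable
`∏ i ∈ g, X i` and the variables `X j`, `j ∈ B`. It is defined for disjoint `g` and `B` by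
the triangular system `M (g ∪ B) = ∑ C ⊆ B, mergedCumulant M g C * M (B \ C)`. -/
noncomputable def mergedCumulant (M : Finset ι → R) (g : Finset ι) (B : Finset ι) : R :=
  M (g ∪ B) - ∑ C ∈ B.ssubsets.attach, mergedCumulant M g C.1 * M (B \ C.1)
termination_by B.card
decreasing_by exact Finset.card_lt_card (Finset.mem_ssubsets.1 C.2)

theorem moment_eq_sum_mergedCumulant {M : Finset ι → R} (hM : M ∅ = 1) (g B : Finset ι) :
    M (g ∪ B) = ∑ C ∈ B.powerset, mergedCumulant M g C * M (B \ C) := by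
  have h : B.powerset = insert B B.ssubsets := by
    rw [Finset.ssubsets, Finset.insert_erase (Finset.mem_powerset_self B)]
  rw [h, Finset.sum_insert (by simp), Finset.sdiff_self, hM, mul_one]
  conv_rhs => enter [1]; rw [mergedCumulant]
  rw [Finset.sum_attach B.ssubsets (fun C => mergedCumulant M g C * M (B \ C))]
  ring

theorem mergedCumulant_empty {M : Finset ι → R} (hM : M ∅ = 1) (g : Finset ι) :
    mergedCumulant M g ∅ = M g := by
  have := moment_eq_sum_mergedCumulant hM g ∅
  simpa [hM] using this.symm

theorem mergedCumulant_congr {M M' : Finset ι → R}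
    {g B : Finset ι} (h : ∀ U ⊆ g ∪ B, M U = M' U) :
    mergedCumulant M g B = mergedCumulant M' g B := by
  induction B using Finset.strongInduction with
  | H B ih =>
    rw [mergedCumulant, mergedCumulant, h _ subset_rfl]
    congr 1
    refine Finset.sum_congr rfl fun C _ => ?_
    have hC := Finset.mem_ssubsets.1 C.2
    rw [ih C.1 hC fun U hU => h U (hU.trans (Finset.union_subset_union subset_rfl hC.1)),
      h _ (Finset.sdiff_subset.trans Finset.subset_union_right)]

/-- The triangular system defining the cumulants has only one solution. -/
theorem eq_of_sum_mul_eq {M : Finset ι → R} (hM : M ∅ = 1) {f h : Finset ι → R} {B : Finset ι}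
    (H : ∀ C ⊆ B, ∑ D ∈ C.powerset, f D * M (C \ D) = ∑ D ∈ C.powerset, h D * M (C \ D)) :
    f B = h B := by
  induction B using Finset.strongInduction with
  | H B ih =>
    have hB := H B subset_rfl
    have hp : B.powerset = insert B B.ssubsets := by
      rw [Finset.ssubsets, Finset.insert_erase (Finset.mem_powerset_self B)]
    rw [hp, Finset.sum_insert (by simp), Finset.sum_insert (by simp), Finset.sdiff_self, hM,
      mul_one, mul_one] at hB
    have : ∑ D ∈ B.ssubsets, f D * M (B \ D) = ∑ D ∈ B.ssubsets, h D * M (B \ D) := by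
      refine Finset.sum_congr rfl fun D hD => ?_
      rw [Finset.mem_ssubsets] at hD
      rw [ih D hD fun C hC => H C (hC.trans hD.1)]
    rw [this] at hB
    exact add_right_cancel hB

/-- Moving an element `j` into the block `g`: the formula expressing the cumulants of a product of
two variables through joint cumulants. -/
theorem mergedCumulant_insert {M : Finset ι → R} (hM : M ∅ = 1) (g B : Finset ι) {j : ι}
    (hj : j ∉ B) :
    mergedCumulant M g (insert j B) = mergedCumulant M (insert j g) B
      - ∑ C ∈ B.powerset, mergedCumulant M g C * mergedCumulant M {j} (B \ C) := by
  rw [eq_sub_iff_add_eq]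
  refine eq_of_sum_mul_eq hM (B := B)
    (f := fun B => mergedCumulant M g (insert j B)
      + ∑ C ∈ B.powerset, mergedCumulant M g C * mergedCumulant M {j} (B \ C))
    (h := fun B => mergedCumulant M (insert j g) B) fun C hC => ?_
  have hjC : j ∉ C := fun h => hj (hC h)
  rw [← moment_eq_sum_mergedCumulant hM]
  have h1 := moment_eq_sum_mergedCumulant hM g (insert j C)
  rw [Finset.sum_powerset_insert hjC] at h1
  have h2 : insert j g ∪ C = g ∪ insert j C := by grind
  rw [h2, h1, add_comm]
  simp_rw [add_mul, Finset.sum_add_distrib]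
  congr 1
  · refine Finset.sum_congr rfl fun D hD => ?_
    rw [Finset.mem_powerset] at hD
    have : insert j C \ insert j D = C \ D := by grind
    rw [this]
  · have h3 := sum_powerset_sdiff
      (fun J D E => mergedCumulant M g J * mergedCumulant M {j} D * M E) C
    simp_rw [Finset.sum_mul]
    rw [← h3]
    refine Finset.sum_congr rfl fun D hD => ?_
    rw [Finset.mem_powerset] at hD
    have : insert j C \ D = {j} ∪ C \ D := by grind
    rw [this, moment_eq_sum_mergedCumulant hM, Finset.mul_sum]
    exact Finset.sum_congr rfl fun E _ => by ring

/-- The joint cumulant of individual variables does not depend on which of them is singled out. -/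
theorem mergedCumulant_singleton_comm {M : Finset ι → R} (hM : M ∅ = 1) {i j : ι}
    {B : Finset ι} (hi : i ∉ B) (hj : j ∉ B) :
    mergedCumulant M {i} (insert j B) = mergedCumulant M {j} (insert i B) := by
  rw [mergedCumulant_insert hM _ _ hj, mergedCumulant_insert hM _ _ hi,
    sum_powerset_comm (fun C D => mergedCumulant M {i} C * mergedCumulant M {j} D),
    Finset.pair_comm]
  congr 1
  exact Finset.sum_congr rfl fun E _ => by ring

/-- A joint cumulant vanishes as soon as the variables split into two independent groups. -/
theorem mergedCumulant_eq_zero {M : Finset ι → R} (hM : M ∅ = 1) {g B : Finset ι}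
    (hB : B.Nonempty) (h : ∀ C ⊆ B, M (g ∪ C) = M g * M C) : mergedCumulant M g B = 0 := by
  have : mergedCumulant M g B = if B = ∅ then M g else 0 := by
    refine eq_of_sum_mul_eq hM (h := fun B => if B = ∅ then M g else 0) fun C hC => ?_
    rw [← moment_eq_sum_mergedCumulant hM, h C hC]
    rw [Finset.sum_eq_single ∅]
    · simp
    · intro b _ hb
      simp [hb]
    · simp
  rw [this, if_neg hB.ne_empty]

end Cumulant

/-! ### Weighted forests and the bound for joint cumulants -/

section Forest

variable {ι : Type*} [DecidableEq ι]

/-- The total weight of the forests on `g ∪ B` in which every tree contains exactly one vertex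
of `g`; a forest has the product of its edge weights `w` as its weight. The recursion sums
over the set `J` of those elements of `B` that are attached directly to `g`. -/
noncomputable def forestSum (w : ι → ι → ℝ) (g : Finset ι) (B : Finset ι) : ℝ :=
  if B = ∅ then 1 else
    ∑ J ∈ {J ∈ B.powerset | J.Nonempty}.attach,
      (∏ j ∈ J.1, ∑ i ∈ g, w i j) * forestSum w J.1 (B \ J.1)
termination_by B.card
decreasing_by
  have hJ := J.2
  rw [Finset.mem_filter, Finset.mem_powerset] at hJ
  exact Finset.card_lt_card (Finset.sdiff_ssubset hJ.1 hJ.2)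

theorem forestSum_empty (w : ι → ι → ℝ) (g : Finset ι) : forestSum w g ∅ = 1 := by
  rw [forestSum]; simp

theorem forestSum_of_nonempty (w : ι → ι → ℝ) (g : Finset ι) {B : Finset ι} (hB : B.Nonempty) :
    forestSum w g B = ∑ J ∈ B.powerset with J.Nonempty,
      (∏ j ∈ J, ∑ i ∈ g, w i j) * forestSum w J (B \ J) := by
  rw [forestSum, if_neg hB.ne_empty]
  exact Finset.sum_attach {J ∈ B.powerset | J.Nonempty}
    (fun J => (∏ j ∈ J, ∑ i ∈ g, w i j) * forestSum w J (B \ J))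

theorem forestSum_empty_left (w : ι → ι → ℝ) (B : Finset ι) :
    forestSum w ∅ B = if B = ∅ then 1 else 0 := by
  split_ifs with h
  · rw [h, forestSum_empty]
  · rw [forestSum_of_nonempty w _ (Finset.nonempty_iff_ne_empty.2 h)]
    refine Finset.sum_eq_zero fun J hJ => ?_
    rw [Finset.mem_filter] at hJ
    simp [hJ.2.ne_empty]

theorem forestSum_eq (w : ι → ι → ℝ) (g B : Finset ι) :
    forestSum w g B = ∑ J ∈ B.powerset,
      (∏ j ∈ J, ∑ i ∈ g, w i j) * forestSum w J (B \ J) := by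
  rcases B.eq_empty_or_nonempty with rfl | hB
  · simp [forestSum_empty]
  · rw [forestSum_of_nonempty w g hB, Finset.sum_filter]
    refine Finset.sum_congr rfl fun J _ => ?_
    split_ifs with h
    · rfl
    · rw [Finset.not_nonempty_iff_eq_empty] at h
      simp [h, forestSum_empty_left, hB.ne_empty]

theorem forestSum_nonneg {w : ι → ι → ℝ} (hw : ∀ i j, 0 ≤ w i j) (g B : Finset ι) :
    0 ≤ forestSum w g B := by
  induction B using Finset.strongInduction generalizing g with
  | H B ih =>
    rcases B.eq_empty_or_nonempty with rfl | hB
    · simp [forestSum_empty]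
    · rw [forestSum_of_nonempty w g hB]
      refine Finset.sum_nonneg fun J hJ => ?_
      rw [Finset.mem_filter, Finset.mem_powerset] at hJ
      exact mul_nonneg (Finset.prod_nonneg fun j _ => Finset.sum_nonneg fun i _ => hw i j)
        (ih _ (Finset.sdiff_ssubset hJ.1 hJ.2) _)

theorem exists_nat_eq_forestSum {w : ι → ι → ℝ}
    (hw : ∀ i j, ∃ n : ℕ, w i j = n) (g B : Finset ι) : ∃ n : ℕ, forestSum w g B = n := by
  choose c hc using hw
  induction B using Finset.strongInduction generalizing g with
  | H B ih =>
    rcases B.eq_empty_or_nonempty with rfl | hB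
    · exact ⟨1, by simp [forestSum_empty]⟩
    · have h : ∀ J : Finset ι, ∃ n : ℕ, J ∈ B.powerset.filter (·.Nonempty) →
          forestSum w J (B \ J) = n := by
        intro J
        by_cases hJ : J ∈ B.powerset.filter (·.Nonempty)
        · rw [Finset.mem_filter, Finset.mem_powerset] at hJ
          obtain ⟨n, hn⟩ := ih _ (Finset.sdiff_ssubset hJ.1 hJ.2) J
          exact ⟨n, fun _ => hn⟩
        · exact ⟨0, fun h => absurd h hJ⟩
      choose n hn using h
      refine ⟨∑ J ∈ B.powerset with J.Nonempty, (∏ j ∈ J, ∑ i ∈ g, c i j) * n J, ?_⟩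
      rw [forestSum_of_nonempty w g hB]
      push_cast
      refine Finset.sum_congr rfl fun J hJ => ?_
      rw [hn J hJ]
      simp_rw [hc]

/-- A forest rooted in `g ∪ g'` is a forest rooted in `g` next to a forest rooted in `g'`. -/
theorem forestSum_union (w : ι → ι → ℝ) {g g' : Finset ι} (hg : Disjoint g g') (B : Finset ι) :
    forestSum w (g ∪ g') B
      = ∑ C ∈ B.powerset, forestSum w g C * forestSum w g' (B \ C) := by
  induction B using Finset.strongInduction generalizing g g' with
  | H B ih =>
    have key : ∀ J ∈ B.powerset, (∏ j ∈ J, ∑ i ∈ g ∪ g', w i j) * forestSum w J (B \ J)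
        = ∑ K ∈ J.powerset, ∑ C ∈ (B \ J).powerset,
          (∏ j ∈ K, ∑ i ∈ g, w i j) * (∏ j ∈ J \ K, ∑ i ∈ g', w i j) *
            (forestSum w K C * forestSum w (J \ K) ((B \ J) \ C)) := by
      intro J hJ
      rw [Finset.mem_powerset] at hJ
      simp_rw [Finset.sum_union hg]
      rw [Finset.prod_add, Finset.sum_mul]
      refine Finset.sum_congr rfl fun K hK => ?_
      rw [Finset.mem_powerset] at hK
      rw [← Finset.mul_sum]
      congr 1
      rcases J.eq_empty_or_nonempty with rfl | hJ'
      · obtain rfl := Finset.subset_empty.1 hK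
        rw [Finset.sdiff_self]
        rw [Finset.sum_eq_single ∅]
        · simp [forestSum_empty_left]
        · intro C _ hC
          simp [forestSum_empty_left, hC]
        · simp
      · conv_lhs => rw [← Finset.union_sdiff_of_subset hK]
        rw [Finset.union_sdiff_of_subset hK]
        rw [← ih _ (Finset.sdiff_ssubset hJ hJ') Finset.disjoint_sdiff,
          Finset.union_sdiff_of_subset hK]
    rw [forestSum_eq, Finset.sum_congr rfl key,
      sum_powerset_four (fun K K' C C' => (∏ j ∈ K, ∑ i ∈ g, w i j) *
        (∏ j ∈ K', ∑ i ∈ g', w i j) * (forestSum w K C * forestSum w K' C'))]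
    refine Finset.sum_congr rfl fun D _ => ?_
    rw [forestSum_eq w g D, forestSum_eq w g' (B \ D), Finset.sum_mul_sum]
    exact Finset.sum_congr rfl fun K _ => Finset.sum_congr rfl fun K' _ => by ring

/-- Contracting an edge between `g` and `j`: the forests that use this edge are at most all
forests. -/
theorem forestSum_insert_le {w : ι → ι → ℝ} (hw : ∀ i j, 0 ≤ w i j) {g B : Finset ι} {j : ι}
    (hjg : j ∉ g) (hjB : j ∉ B) (h1 : 1 ≤ ∑ i ∈ g, w i j) :
    forestSum w (insert j g) B ≤ forestSum w g (insert j B) := by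
  have hd : ∀ (g : Finset ι) (J : Finset ι), 0 ≤ ∏ j ∈ J, ∑ i ∈ g, w i j := fun g J =>
    Finset.prod_nonneg fun j _ => Finset.sum_nonneg fun i _ => hw i j
  have hsplit : ∀ {g B : Finset ι}, j ∉ g → forestSum w (insert j g) B
      = ∑ C ∈ B.powerset, forestSum w g C * forestSum w {j} (B \ C) := by
    intro g B hjg
    rw [Finset.insert_eq, Finset.union_comm,
      forestSum_union w (Finset.disjoint_singleton_right.2 hjg)]
  rw [forestSum_eq w g (insert j B), Finset.sum_powerset_insert hjB]
  refine le_add_of_nonneg_of_le (Finset.sum_nonneg fun J _ =>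
    mul_nonneg (hd _ _) (forestSum_nonneg hw _ _)) ?_
  calc forestSum w (insert j g) B
      = ∑ J ∈ B.powerset, (∏ j ∈ J, ∑ i ∈ g, w i j) * forestSum w (insert j J) (B \ J) := by
        rw [hsplit hjg]
        have := sum_powerset_sdiff (fun J C E => (∏ j ∈ J, ∑ i ∈ g, w i j) *
          (forestSum w J C * forestSum w {j} E)) B
        trans ∑ D ∈ B.powerset, ∑ J ∈ D.powerset, (∏ j ∈ J, ∑ i ∈ g, w i j) *
          (forestSum w J (D \ J) * forestSum w {j} (B \ D))
        · refine Finset.sum_congr rfl fun D _ => ?_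
          rw [forestSum_eq w g D, Finset.sum_mul]
          exact Finset.sum_congr rfl fun J _ => by ring
        · rw [← this]
          refine Finset.sum_congr rfl fun J hJ => ?_
          rw [Finset.mem_powerset] at hJ
          rw [hsplit (fun h => hjB (hJ h)), Finset.mul_sum]
    _ ≤ _ := by
        refine Finset.sum_le_sum fun J hJ => ?_
        rw [Finset.mem_powerset] at hJ
        have hjJ : j ∉ J := fun h => hjB (hJ h)
        have : insert j B \ insert j J = B \ J := by grind
        rw [this, Finset.prod_insert hjJ]
        refine mul_le_mul_of_nonneg_right ?_ (forestSum_nonneg hw _ _)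
        exact le_mul_of_one_le_left (hd _ _) h1

open Classical in
/-- The cumulant bound for moments that factorize along a graph: every edge of a spanning forest
contributes a factor `2`, because a cumulant is unfolded along an edge either by merging its
endpoints or by splitting the cumulant in two. -/
theorem abs_mergedCumulant_le {M : Finset ι → ℝ} (hM : M ∅ = 1) {adj : ι → ι → Prop}
    {a : ι → ℝ}
    (hfac : ∀ g B : Finset ι, Disjoint g B → (∀ i ∈ g, ∀ j ∈ B, ¬ adj i j) →
      M (g ∪ B) = M g * M B)
    (hMa : ∀ g, |M g| ≤ ∏ i ∈ g, a i) {g B : Finset ι} (hgB : Disjoint g B) :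
    |mergedCumulant M g B|
      ≤ 2 ^ B.card * forestSum (fun i j => if adj i j then 1 else 0) g B * ∏ i ∈ g ∪ B, a i := by
  set w : ι → ι → ℝ := fun i j => if adj i j then 1 else 0 with hw_def
  have hw : ∀ i j, 0 ≤ w i j := fun i j => by simp only [hw_def]; split_ifs <;> norm_num
  have ha' : ∀ g : Finset ι, 0 ≤ ∏ i ∈ g, a i := fun g => (abs_nonneg _).trans (hMa g)
  induction B using Finset.strongInduction generalizing g with
  | H B ih =>
    rcases B.eq_empty_or_nonempty with rfl | hBne
    · rw [mergedCumulant_empty hM]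
      simpa [forestSum_empty] using hMa g
    -- Either some `j ∈ B` can be merged into `g`, or `g` is independent of all of `B`.
    by_cases hadj : ∃ j ∈ B, ∃ i ∈ g, adj i j
    · obtain ⟨j, hjB, i, hig, hij⟩ := hadj
      have hjg : j ∉ g := fun h => (Finset.disjoint_left.1 hgB h hjB)
      obtain ⟨B', hjB', rfl⟩ : ∃ B', j ∉ B' ∧ insert j B' = B :=
        ⟨B.erase j, Finset.notMem_erase j B, Finset.insert_erase hjB⟩
      have hgB' : Disjoint g B' := hgB.mono_right (Finset.subset_insert _ _)
      have hlt : B' ⊂ insert j B' := Finset.ssubset_insert hjB'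
      set A := ∏ i ∈ g ∪ insert j B', a i with hA
      have hu : insert j g ∪ B' = g ∪ insert j B' := by grind
      have hdeg : 1 ≤ ∑ i ∈ g, w i j := by
        refine le_trans ?_ (Finset.single_le_sum (fun i _ => hw i j) hig)
        simp [hw_def, hij]
      have hI := ih B' hlt (g := insert j g) (Finset.disjoint_insert_left.2 ⟨hjB', hgB'⟩)
      rw [hu] at hI
      have hII : ∀ C ∈ B'.powerset, |mergedCumulant M g C * mergedCumulant M {j} (B' \ C)|
          ≤ 2 ^ B'.card * (forestSum w g C * forestSum w {j} (B' \ C)) * A := by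
        intro C hC
        rw [Finset.mem_powerset] at hC
        have h1 := ih C (lt_of_le_of_lt hC hlt) (g := g) (hgB'.mono_right hC)
        have h2 := ih (B' \ C) (lt_of_le_of_lt Finset.sdiff_subset hlt) (g := {j})
          (Finset.disjoint_singleton_left.2 fun h => hjB' (Finset.sdiff_subset h))
        rw [abs_mul]
        refine (mul_le_mul h1 h2 (abs_nonneg _) ((abs_nonneg _).trans h1)).trans (le_of_eq ?_)
        have hprod : (∏ i ∈ g ∪ C, a i) * ∏ i ∈ {j} ∪ B' \ C, a i = A := by
          have hdisj : Disjoint (g ∪ C) ({j} ∪ B' \ C) := by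
            rw [Finset.disjoint_left] at hgB' ⊢
            clear * - hgB' hC hjg hjB'
            grind
          have hunion : (g ∪ C) ∪ ({j} ∪ B' \ C) = g ∪ insert j B' := by
            clear * - hC
            grind
          rw [← Finset.prod_union hdisj, hA, hunion]
        rw [← hprod, ← Finset.card_sdiff_add_card_eq_card hC, pow_add]
        ring
      rw [mergedCumulant_insert hM _ _ hjB']
      calc |mergedCumulant M (insert j g) B'
            - ∑ C ∈ B'.powerset, mergedCumulant M g C * mergedCumulant M {j} (B' \ C)|
          ≤ |mergedCumulant M (insert j g) B'|
            + |∑ C ∈ B'.powerset, mergedCumulant M g C * mergedCumulant M {j} (B' \ C)| :=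
            abs_sub _ _
        _ ≤ 2 ^ B'.card * forestSum w (insert j g) B' * A
            + ∑ C ∈ B'.powerset, 2 ^ B'.card * (forestSum w g C * forestSum w {j} (B' \ C)) * A :=
            add_le_add hI ((Finset.abs_sum_le_sum_abs _ _).trans (Finset.sum_le_sum hII))
        _ = 2 ^ (insert j B').card * forestSum w (insert j g) B' * A := by
            rw [← Finset.sum_mul, ← Finset.mul_sum, ← forestSum_union w
              (Finset.disjoint_singleton_right.2 hjg), Finset.union_comm g {j},
              ← Finset.insert_eq, Finset.card_insert_of_notMem hjB']
            ring
        _ ≤ _ := by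
            refine mul_le_mul_of_nonneg_right (mul_le_mul_of_nonneg_left
              (forestSum_insert_le hw hjg hjB' hdeg) (by positivity)) (ha' _)
    · push Not at hadj
      rw [mergedCumulant_eq_zero hM hBne fun C hC => ?_]
      · simp only [abs_zero]
        exact mul_nonneg (mul_nonneg (by positivity) (forestSum_nonneg hw _ _)) (ha' _)
      · exact hfac g C (hgB.mono_right hC) fun i hi j hj => hadj j (hC hj) i hi

end Forest

/-! ### Summing weighted forests over all labelings -/

section Labeling

variable {ι V : Type*} [Fintype ι] [DecidableEq ι] [Fintype V]

open Classical in
/-- The sum of `f` over all labelings `k : ι → V` that agree with `k₀` outside of `B`. -/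
noncomputable def labelSum (B : Finset ι) (f : (ι → V) → ℝ) (k₀ : ι → V) : ℝ :=
  ∑ k : ι → V with ∀ i ∉ B, k i = k₀ i, f k

theorem labelSum_empty (f : (ι → V) → ℝ) (k₀ : ι → V) : labelSum ∅ f k₀ = f k₀ := by
  classical
  rw [labelSum, Finset.sum_eq_single k₀]
  · intro k hk hne
    rw [Finset.mem_filter] at hk
    exact absurd (funext fun i => hk.2 i (by simp)) hne
  · simp

theorem labelSum_univ (f : (ι → V) → ℝ) (k₀ : ι → V) :
    labelSum Finset.univ f k₀ = ∑ k, f k := by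
  classical
  rw [labelSum]
  congr 1
  ext; simp

theorem labelSum_union {A B : Finset ι} (h : Disjoint A B) (f : (ι → V) → ℝ) (k₀ : ι → V) :
    labelSum (A ∪ B) f k₀ = labelSum A (labelSum B f) k₀ := by
  classical
  simp only [labelSum]
  rw [Finset.sum_sigma']
  refine Finset.sum_bij' (fun k _ => ⟨fun i => if i ∈ A then k i else k₀ i, k⟩)
    (fun x _ => x.2) ?_ ?_ ?_ ?_ ?_
  · intro k hk
    simp only [Finset.mem_filter, Finset.mem_univ, true_and, Finset.mem_sigma,
      Finset.mem_union, not_or] at hk ⊢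
    refine ⟨fun i hi => by simp [hi], fun i hi => ?_⟩
    split_ifs with hA
    · rfl
    · exact hk i ⟨hA, hi⟩
  · rintro ⟨k, k'⟩ hk
    simp only [Finset.mem_filter, Finset.mem_univ, true_and, Finset.mem_sigma,
      Finset.mem_union, not_or] at hk ⊢
    exact fun i hi => (hk.2 i hi.2).trans (hk.1 i hi.1)
  · intro k _
    rfl
  · rintro ⟨k, k'⟩ hk
    simp only [Finset.mem_filter, Finset.mem_univ, true_and, Finset.mem_sigma] at hk
    simp only [Sigma.mk.injEq, heq_eq_eq, and_true]
    funext i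
    split_ifs with hA
    · exact hk.2 i (Finset.disjoint_left.1 h hA)
    · exact (hk.1 i hA).symm
  · intro k _
    rfl

theorem labelSum_singleton (j : ι) (f : (ι → V) → ℝ) (k₀ : ι → V) :
    labelSum {j} f k₀ = ∑ v, f (Function.update k₀ j v) := by
  classical
  rw [labelSum]
  refine Finset.sum_bij' (fun k _ => k j) (fun v _ => Function.update k₀ j v) ?_ ?_ ?_ ?_ ?_
  · simp
  · intro v _
    simp only [Finset.mem_filter, Finset.mem_univ, true_and, Finset.mem_singleton]
    exact fun i hi => Function.update_of_ne hi _ _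
  · intro k hk
    simp only [Finset.mem_filter, Finset.mem_univ, true_and, Finset.mem_singleton] at hk
    funext i
    by_cases hi : i = j
    · subst hi; simp
    · rw [Function.update_of_ne hi, hk i hi]
  · simp
  · intro k hk
    simp only [Finset.mem_filter, Finset.mem_univ, true_and, Finset.mem_singleton] at hk
    congr 1
    funext i
    by_cases hi : i = j
    · subst hi; simp
    · rw [Function.update_of_ne hi, hk i hi]

theorem labelSum_congr {B : Finset ι} {f h : (ι → V) → ℝ} {k₀ : ι → V}
    (H : ∀ k, (∀ i ∉ B, k i = k₀ i) → f k = h k) : labelSum B f k₀ = labelSum B h k₀ := by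
  classical
  exact Finset.sum_congr rfl fun k hk => H k (Finset.mem_filter.1 hk).2

theorem labelSum_mono {B : Finset ι} {f h : (ι → V) → ℝ} {k₀ : ι → V}
    (H : ∀ k, (∀ i ∉ B, k i = k₀ i) → f k ≤ h k) : labelSum B f k₀ ≤ labelSum B h k₀ := by
  classical
  exact Finset.sum_le_sum fun k hk => H k (Finset.mem_filter.1 hk).2

theorem labelSum_sum {κ : Type*} (s : Finset κ) (B : Finset ι) (f : κ → (ι → V) → ℝ)
    (k₀ : ι → V) : labelSum B (fun k => ∑ x ∈ s, f x k) k₀ = ∑ x ∈ s, labelSum B (f x) k₀ :=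
  Finset.sum_comm

theorem labelSum_const_mul (c : ℝ) (B : Finset ι) (f : (ι → V) → ℝ) (k₀ : ι → V) :
    labelSum B (fun k => c * f k) k₀ = c * labelSum B f k₀ :=
  (Finset.mul_sum _ _ _).symm

theorem labelSum_mul_of_agree {B : Finset ι} {h : (ι → V) → ℝ} {k₀ : ι → V}
    (H : ∀ k, (∀ i ∉ B, k i = k₀ i) → h k = h k₀) (f : (ι → V) → ℝ) :
    labelSum B (fun k => h k * f k) k₀ = h k₀ * labelSum B f k₀ := by
  rw [← labelSum_const_mul]
  exact labelSum_congr fun k hk => by rw [H k hk]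

theorem labelSum_prod (J : Finset ι) (h : ι → V → ℝ) (k₀ : ι → V) :
    labelSum J (fun k => ∏ j ∈ J, h j (k j)) k₀ = ∏ j ∈ J, ∑ v, h j v := by
  induction J using Finset.induction_on generalizing k₀ with
  | empty => simp [labelSum_empty]
  | insert j J hj ih =>
    rw [Finset.insert_eq, labelSum_union (Finset.disjoint_singleton_left.2 hj),
      labelSum_singleton, ← Finset.insert_eq, Finset.prod_insert hj, Finset.sum_mul]
    refine Finset.sum_congr rfl fun v _ => ?_
    simp_rw [Finset.prod_insert hj]
    rw [labelSum_mul_of_agree (h := fun k => h j (k j)) fun k hk => by rw [hk j hj], ih]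
    simp

/-- The number `m (m + n) ^ (n - 1)` of forests on `m + n` vertices, of which `m` are the roots. -/
noncomputable def forestCount (m n : ℕ) : ℝ :=
  if n = 0 then 1 else m * ((m : ℝ) + n) ^ (n - 1)

theorem forestCount_nonneg (m n : ℕ) : 0 ≤ forestCount m n := by
  unfold forestCount; split_ifs <;> positivity

/-- The number of rooted forests, counted according to the number `j` of the neighbours of the
roots. -/
theorem sum_choose_mul_forestCount (m n : ℕ) (hn : n ≠ 0) :
    ∑ j ∈ Finset.range (n + 1), (n.choose j : ℝ) * ((m : ℝ) ^ j * forestCount j (n - j))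
      = forestCount m n := by
  obtain ⟨p, rfl⟩ := Nat.exists_eq_succ_of_ne_zero hn
  rw [Finset.sum_range_succ']
  have hterm : ∀ i ∈ Finset.range (p + 1), ((p + 1).choose (i + 1) : ℝ) *
      ((m : ℝ) ^ (i + 1) * forestCount (i + 1) (p + 1 - (i + 1)))
      = m * ((m : ℝ) ^ i * ((p : ℝ) + 1) ^ (p - i) * p.choose i) := by
    intro i hi
    have hi' : i ≤ p := by simpa [Nat.lt_succ_iff] using hi
    have hchoose : ((p : ℝ) + 1) * p.choose i = (p + 1).choose (i + 1) * ((i : ℝ) + 1) := by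
      exact_mod_cast Nat.add_one_mul_choose_eq p i
    rcases hi'.eq_or_lt with rfl | hlt
    · simp [forestCount, pow_succ]; ring
    · obtain ⟨q, rfl⟩ := Nat.exists_eq_add_of_lt hlt
      have e1 : i + q + 1 + 1 - (i + 1) = q + 1 := by omega
      have e2 : i + q + 1 - i = q + 1 := by omega
      have e3 : ((i : ℝ) + 1 + (q + 1)) = ((i + q + 1 : ℕ) : ℝ) + 1 := by push_cast; ring
      rw [e1, e2, forestCount, if_neg (by omega)]
      push_cast at hchoose e3 ⊢
      rw [e3]
      calc _ = (m : ℝ) ^ (i + 1) * (((i + q + 1 + 1).choose (i + 1) : ℝ) * ((i : ℝ) + 1))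
              * ((i : ℝ) + q + 1 + 1) ^ q := by ring
        _ = _ := by rw [← hchoose]; ring
  -- After the termwise rewriting this is the binomial theorem.
  rw [Finset.sum_congr rfl hterm, ← Finset.mul_sum, ← add_pow]
  simp [forestCount]

/-- Summing over the labels of `B`, every edge of a forest contributes at most the degree
bound `Δ`. -/
theorem labelSum_forestSum_le {w : V → V → ℝ} (hw : ∀ u v, 0 ≤ w u v) {Δ : ℝ}
    (hΔ : ∀ u, ∑ v, w u v ≤ Δ) {g B : Finset ι} (hgB : Disjoint g B) (k₀ : ι → V) :
    labelSum B (fun k => forestSum (fun i j => w (k i) (k j)) g B) k₀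
      ≤ forestCount g.card B.card * Δ ^ B.card := by
  induction B using Finset.strongInduction generalizing g k₀ with
  | H B ih =>
    rcases B.eq_empty_or_nonempty with rfl | hB
    · simp [labelSum_empty, forestSum_empty, forestCount]
    have hw' : ∀ (k : ι → V) (i j : ι), 0 ≤ w (k i) (k j) := fun k i j => hw _ _
    have hΔ0 : 0 ≤ Δ := by
      obtain ⟨b, _⟩ := hB
      exact (Finset.sum_nonneg fun v _ => hw (k₀ b) v).trans (hΔ (k₀ b))
    have hterm : ∀ J ∈ B.powerset.filter (·.Nonempty),
        labelSum B (fun k => (∏ j ∈ J, ∑ i ∈ g, w (k i) (k j)) *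
          forestSum (fun i j => w (k i) (k j)) J (B \ J)) k₀
          ≤ (g.card : ℝ) ^ J.card * forestCount J.card (B.card - J.card) * Δ ^ B.card := by
      intro J hJ
      rw [Finset.mem_filter, Finset.mem_powerset] at hJ
      have hcard : (B \ J).card = B.card - J.card := Finset.card_sdiff_of_subset hJ.1
      have hle := Finset.card_le_card hJ.1
      have hgJ : ∀ i ∈ g, i ∉ B := fun i hi => Finset.disjoint_left.1 hgB hi
      calc labelSum B (fun k => (∏ j ∈ J, ∑ i ∈ g, w (k i) (k j)) *
              forestSum (fun i j => w (k i) (k j)) J (B \ J)) k₀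
          = labelSum J (labelSum (B \ J) (fun k => (∏ j ∈ J, ∑ i ∈ g, w (k i) (k j)) *
              forestSum (fun i j => w (k i) (k j)) J (B \ J))) k₀ := by
            rw [← labelSum_union Finset.disjoint_sdiff, Finset.union_sdiff_of_subset hJ.1]
        _ ≤ labelSum J (fun k => (forestCount J.card (B \ J).card * Δ ^ (B \ J).card) *
              ∏ j ∈ J, ∑ i ∈ g, w (k₀ i) (k j)) k₀ := by
            refine labelSum_mono fun k hk => ?_
            rw [labelSum_mul_of_agree (h := fun k => ∏ j ∈ J, ∑ i ∈ g, w (k i) (k j))]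
            · rw [mul_comm]
              have h1 : ∏ j ∈ J, ∑ i ∈ g, w (k i) (k j) = ∏ j ∈ J, ∑ i ∈ g, w (k₀ i) (k j) :=
                Finset.prod_congr rfl fun j _ => Finset.sum_congr rfl fun i hi => by
                  rw [hk i fun h => hgJ i hi (hJ.1 h)]
              rw [h1]
              exact mul_le_mul_of_nonneg_right
                (ih _ (Finset.sdiff_ssubset hJ.1 hJ.2) Finset.disjoint_sdiff k)
                (Finset.prod_nonneg fun j _ => Finset.sum_nonneg fun i _ => hw _ _)
            · intro k' hk'
              refine Finset.prod_congr rfl fun j hj => Finset.sum_congr rfl fun i hi => ?_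
              rw [hk' i fun h => hgJ i hi (Finset.sdiff_subset h),
                hk' j fun h => (Finset.mem_sdiff.1 h).2 hj]
        _ = (forestCount J.card (B \ J).card * Δ ^ (B \ J).card) *
              ∏ j ∈ J, ∑ v, ∑ i ∈ g, w (k₀ i) v := by
            rw [labelSum_const_mul, labelSum_prod J (fun _ v => ∑ i ∈ g, w (k₀ i) v)]
        _ ≤ (forestCount J.card (B \ J).card * Δ ^ (B \ J).card) * ((g.card : ℝ) * Δ) ^ J.card := by
            refine mul_le_mul_of_nonneg_left ?_
              (mul_nonneg (forestCount_nonneg _ _) (pow_nonneg hΔ0 _))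
            rw [← Finset.prod_const]
            refine Finset.prod_le_prod (fun j _ => Finset.sum_nonneg fun v _ =>
              Finset.sum_nonneg fun i _ => hw _ _) fun j _ => ?_
            rw [Finset.sum_comm, ← nsmul_eq_mul]
            exact Finset.sum_le_card_nsmul _ _ _ fun i _ => hΔ _
        _ = (g.card : ℝ) ^ J.card * forestCount J.card (B.card - J.card) *
              (Δ ^ (B.card - J.card) * Δ ^ J.card) := by
            rw [hcard, mul_pow]; ring
        _ = _ := by rw [← pow_add, Nat.sub_add_cancel hle]
    calc labelSum B (fun k => forestSum (fun i j => w (k i) (k j)) g B) k₀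
        = ∑ J ∈ B.powerset with J.Nonempty,
            labelSum B (fun k => (∏ j ∈ J, ∑ i ∈ g, w (k i) (k j)) *
              forestSum (fun i j => w (k i) (k j)) J (B \ J)) k₀ := by
          rw [← labelSum_sum]
          exact labelSum_congr fun k _ => forestSum_of_nonempty _ _ hB
      _ ≤ ∑ J ∈ B.powerset with J.Nonempty,
            (g.card : ℝ) ^ J.card * forestCount J.card (B.card - J.card) * Δ ^ B.card :=
          Finset.sum_le_sum hterm
      _ ≤ ∑ J ∈ B.powerset,
            (g.card : ℝ) ^ J.card * forestCount J.card (B.card - J.card) * Δ ^ B.card :=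
          Finset.sum_le_sum_of_subset_of_nonneg (Finset.filter_subset _ _) fun J _ _ =>
            mul_nonneg (mul_nonneg (by positivity) (forestCount_nonneg _ _)) (pow_nonneg hΔ0 _)
      _ = forestCount g.card B.card * Δ ^ B.card := by
          rw [← Finset.sum_mul, ← sum_choose_mul_forestCount _ _
            (Finset.card_ne_zero.2 hB),
            Finset.sum_powerset_apply_card
              (fun m => (g.card : ℝ) ^ m * forestCount m (B.card - m))]
          simp [nsmul_eq_mul]

end Labeling

/-! ### Moments of a family with a dependency graph -/

section Moments

variable {V Ω : Type*} [MeasurableSpace Ω]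

/-- Two vertices interact if they are equal or joined by an edge. -/
def Interacts (G : Multigraph V) (u v : V) : Prop := u = v ∨ s(u, v) ∈ G

/-- The moment `E[∏ i ∈ U, X (k i)]`. -/
noncomputable def labelMoment {ι : Type*} (P : Measure Ω) (X : V → Ω → ℝ) (k : ι → V)
    (U : Finset ι) : ℝ := ∫ ω, ∏ i ∈ U, X (k i) ω ∂P

variable {P : Measure Ω} {X : V → Ω → ℝ} {G : Multigraph V} {L : ℝ}

theorem ae_abs_prod_le {ι : Type*} (hb : ∀ v, ∀ᵐ ω ∂P, |X v ω| ≤ L) (k : ι → V)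
    (U : Finset ι) : ∀ᵐ ω ∂P, |∏ i ∈ U, X (k i) ω| ≤ L ^ U.card := by
  have : ∀ᵐ ω ∂P, ∀ i ∈ U, |X (k i) ω| ≤ L :=
    (ae_ball_iff U.countable_toSet).2 fun i _ => hb (k i)
  filter_upwards [this] with ω hω
  rw [Finset.abs_prod]
  exact (Finset.prod_le_prod (fun _ _ => abs_nonneg _) hω).trans_eq (Finset.prod_const L)

theorem labelMoment_union {ι : Type*} [DecidableEq ι] (hX : ∀ v, Measurable (X v))
    (hG : IsDependencyGraph P X G) (k : ι → V) {g B : Finset ι} (hgB : Disjoint g B)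
    (h : ∀ i ∈ g, ∀ j ∈ B, ¬ Interacts G (k i) (k j)) :
    labelMoment P X k (g ∪ B) = labelMoment P X k g * labelMoment P X k B := by
  classical
  have hind := hG (k '' g) (k '' B) ?_ ?_
  · have hmeas : ∀ (U : Finset ι), Measurable (fun y : (k '' (U : Set ι)) → ℝ =>
        ∏ i ∈ U.attach, y ⟨k i, Set.mem_image_of_mem k i.2⟩) := fun U =>
      Finset.measurable_prod _ fun i _ => measurable_pi_apply _
    have hind' := hind.comp (hmeas g) (hmeas B)
    have := hind'.integral_fun_mul_eq_mul_integral
      ((hmeas g).comp (measurable_pi_lambda _ fun i => hX _)).aestronglyMeasurable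
      ((hmeas B).comp (measurable_pi_lambda _ fun i => hX _)).aestronglyMeasurable
    simp only [Function.comp_apply] at this
    unfold labelMoment
    simp_rw [Finset.prod_union hgB]
    simp_rw [← Finset.prod_attach g (fun i => X (k i) _),
      ← Finset.prod_attach B (fun i => X (k i) _)]
    exact this
  · rw [Set.disjoint_left]
    rintro _ ⟨i, hi, rfl⟩ ⟨j, hj, hij⟩
    exact h i hi j hj (Or.inl hij.symm)
  · rintro _ ⟨i, hi, rfl⟩ _ ⟨j, hj, rfl⟩ hij
    exact h i hi j hj (Or.inr hij)

variable [IsProbabilityMeasure P]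

theorem labelMoment_empty {ι : Type*} (k : ι → V) : labelMoment P X k ∅ = 1 := by
  simp [labelMoment]

theorem integrable_prod {ι : Type*} (hX : ∀ v, Measurable (X v))
    (hb : ∀ v, ∀ᵐ ω ∂P, |X v ω| ≤ L) (k : ι → V) (U : Finset ι) :
    Integrable (fun ω => ∏ i ∈ U, X (k i) ω) P :=
  Integrable.of_bound (Finset.measurable_prod U fun i _ => hX (k i)).aestronglyMeasurable _
    (ae_abs_prod_le hb k U)

/-- Hölder's inequality for products of at most `r` variables. -/
theorem abs_labelMoment_le {ι : Type*} (hX : ∀ v, Measurable (X v))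
    (hb : ∀ v, ∀ᵐ ω ∂P, |X v ω| ≤ L) (k : ι → V) {r : ℕ} (hr : r ≠ 0) {U : Finset ι}
    (hU : U.card ≤ r) :
    |labelMoment P X k U| ≤ ∏ i ∈ U, (∫ ω, |X (k i) ω| ^ r ∂P) ^ (1 / (r : ℝ)) := by
  have hr' : (0 : ℝ) < r := by positivity
  have hnorm : ∀ v, ∫⁻ ω, ‖X v ω‖ₑ ^ r ∂P = ENNReal.ofReal (∫ ω, |X v ω| ^ r ∂P) := by
    intro v
    rw [ofReal_integral_eq_lintegral_ofReal]
    · refine lintegral_congr fun ω => ?_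
      rw [ENNReal.ofReal_pow (abs_nonneg _), ← Real.norm_eq_abs, ofReal_norm]
    · refine Integrable.of_bound ((hX v).abs.pow_const r).aestronglyMeasurable (L ^ r) ?_
      filter_upwards [hb v] with ω hω
      rw [norm_pow, Real.norm_eq_abs, abs_abs]
      exact pow_le_pow_left₀ (abs_nonneg _) hω r
    · exact Filter.Eventually.of_forall fun ω => by positivity
  have hI : ∀ v, 0 ≤ ∫ ω, |X v ω| ^ r ∂P := fun v => integral_nonneg fun ω => by positivity
  have key := ENNReal.lintegral_mul_prod_norm_pow_le (μ := P) U (g := fun _ => 1)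
    (f := fun i ω => ‖X (k i) ω‖ₑ ^ r) aemeasurable_const
    (fun i _ => ((hX (k i)).enorm.pow_const r).aemeasurable) (1 - U.card / (r : ℝ))
    (p := fun _ => 1 / (r : ℝ)) (by simp; field_simp; ring)
    (by rw [sub_nonneg, div_le_one hr']; exact_mod_cast hU) (fun i _ => by positivity)
  simp only [ENNReal.one_rpow, one_mul, lintegral_one, measure_univ, hnorm] at key
  have h1 : ∀ x : ENNReal, (x ^ r) ^ (1 / (r : ℝ)) = x := fun x => by
    rw [← ENNReal.rpow_natCast, ← ENNReal.rpow_mul]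
    rw [mul_one_div_cancel hr'.ne', ENNReal.rpow_one]
  simp only [h1] at key
  have h2 : ENNReal.ofReal |labelMoment P X k U|
      ≤ ∫⁻ ω, ∏ i ∈ U, ‖X (k i) ω‖ₑ ∂P := by
    rw [← Real.norm_eq_abs, ofReal_norm]
    refine (enorm_integral_le_lintegral_enorm _).trans (le_of_eq (lintegral_congr fun ω => ?_))
    rw [← ofReal_norm, norm_prod,
      ENNReal.ofReal_prod_of_nonneg fun i _ => norm_nonneg _]
    simp_rw [ofReal_norm]
  have h3 := h2.trans key
  simp_rw [ENNReal.ofReal_rpow_of_nonneg (hI _) (show (0 : ℝ) ≤ 1 / r by positivity)] at h3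
  rw [← ENNReal.ofReal_prod_of_nonneg fun i _ => Real.rpow_nonneg (hI _) _] at h3
  exact (ENNReal.ofReal_le_ofReal_iff
    (Finset.prod_nonneg fun i _ => Real.rpow_nonneg (hI _) _)).1 h3

open Classical in
/-- At most `D + 1` vertices interact with a given one. -/
theorem sum_interacts_le [Fintype V] {D : ℕ} (hD : maxDegree G ≤ D) (u : V) :
    ∑ v, (if Interacts G u v then (1 : ℝ) else 0) ≤ D + 1 := by
  rw [Finset.sum_boole]
  have hsub : ({v | Interacts G u v} : Finset V) ⊆
      insert u ({v | s(u, v) ∈ G} : Finset V) := by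
    intro v hv
    rw [Finset.mem_filter] at hv
    rw [Finset.mem_insert, Finset.mem_filter]
    exact hv.2.imp Eq.symm fun h => ⟨Finset.mem_univ v, h⟩
  have hdeg : ({v | s(u, v) ∈ G} : Finset V).card ≤ degree G u := by
    unfold degree
    have himg : (({v | s(u, v) ∈ G} : Finset V).image fun v => s(u, v)).card
        = ({v | s(u, v) ∈ G} : Finset V).card :=
      Finset.card_image_of_injective _ fun a b hab => Sym2.congr_right.1 hab
    rw [← himg]
    refine (Finset.card_le_card (t := (Multiset.filter (fun e => u ∈ e) G).toFinset) ?_).trans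
      (Multiset.toFinset_card_le _)
    intro e he
    simp only [Finset.mem_image, Finset.mem_filter, Finset.mem_univ, true_and] at he
    obtain ⟨v, hv, rfl⟩ := he
    simp [hv]
  have hle : degree G u ≤ D := (Finset.le_sup (f := degree G) (Finset.mem_univ u)).trans hD
  have := (Finset.card_le_card hsub).trans (Finset.card_insert_le _ _)
  exact_mod_cast this.trans (Nat.add_le_add_right (hdeg.trans hle) 1)

end Moments

/-! ### Cumulants of the sum -/

section SumCumulants

/-- The cumulant sequence of a moment sequence `m`: the value at `n` is the cumulant of
order `n + 1`, determined by `m (n + 1) = ∑ j ≤ n, n.choose j * κ (j + 1) * m (n - j)`. -/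
noncomputable def cumulantSucc (m : ℕ → ℝ) (n : ℕ) : ℝ :=
  m (n + 1) - ∑ j : Fin n, (n.choose j : ℝ) * (cumulantSucc m j * m (n - j))

theorem moment_succ_eq (m : ℕ → ℝ) (hm : m 0 = 1) (n : ℕ) :
    m (n + 1) = ∑ j ∈ Finset.range (n + 1), (n.choose j : ℝ) * (cumulantSucc m j * m (n - j)) := by
  rw [Finset.sum_range_succ, cumulantSucc,
    Fin.sum_univ_eq_sum_range (fun j => (n.choose j : ℝ) * (cumulantSucc m j * m (n - j)))]
  simp [hm]

variable {ι V Ω : Type*} [Fintype ι] [DecidableEq ι] [Fintype V] [MeasurableSpace Ω]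
  {P : Measure Ω} [IsProbabilityMeasure P] {X : V → Ω → ℝ} {G : Multigraph V} {L : ℝ}

theorem labelSum_labelMoment (hX : ∀ v, Measurable (X v)) (hb : ∀ v, ∀ᵐ ω ∂P, |X v ω| ≤ L)
    (U : Finset ι) (k₀ : ι → V) :
    labelSum U (fun k => labelMoment P X k U) k₀ = ∫ ω, sumRV X ω ^ U.card ∂P := by
  classical
  unfold labelSum labelMoment
  rw [← integral_finsetSum _ fun k _ => integrable_prod hX hb k U]
  refine integral_congr_ae (Filter.Eventually.of_forall fun ω => ?_)
  have := labelSum_prod U (fun _ v => X v ω) k₀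
  rw [labelSum] at this
  simp only [this, Finset.prod_const, sumRV]

/-- Multilinearity: the cumulant of the sum is the sum of the joint cumulants. -/
theorem labelSum_mergedCumulant (hX : ∀ v, Measurable (X v))
    (hb : ∀ v, ∀ᵐ ω ∂P, |X v ω| ≤ L) {i : ι} {B : Finset ι} (hi : i ∉ B) (k₀ : ι → V) :
    labelSum (insert i B) (fun k => mergedCumulant (labelMoment P X k) {i} B) k₀
      = cumulantSucc (fun n => ∫ ω, sumRV X ω ^ n ∂P) B.card := by
  set m : ℕ → ℝ := fun n => ∫ ω, sumRV X ω ^ n ∂P with hm_def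
  have hm : m 0 = 1 := by simp [hm_def]
  induction B using Finset.strongInduction generalizing k₀ with
  | H B ih =>
    have hp : B.powerset = insert B B.ssubsets := by
      rw [Finset.ssubsets, Finset.insert_erase (Finset.mem_powerset_self B)]
    have hlab : ∀ k : ι → V, mergedCumulant (labelMoment P X k) {i} B
        = labelMoment P X k (insert i B) - ∑ C ∈ B.ssubsets,
          mergedCumulant (labelMoment P X k) {i} C * labelMoment P X k (B \ C) := by
      intro k
      rw [Finset.insert_eq, moment_eq_sum_mergedCumulant (labelMoment_empty k), hp,
        Finset.sum_insert (by simp), Finset.sdiff_self, labelMoment_empty]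
      ring
    have hterm : ∀ C ∈ B.ssubsets, labelSum (insert i B) (fun k =>
        mergedCumulant (labelMoment P X k) {i} C * labelMoment P X k (B \ C)) k₀
        = cumulantSucc m C.card * m (B.card - C.card) := by
      intro C hC
      rw [Finset.mem_ssubsets] at hC
      have hsplit : insert i B = insert i C ∪ B \ C := by
        have := hC.1
        clear * - this
        grind
      have hdisj : Disjoint (insert i C) (B \ C) :=
        Finset.disjoint_insert_left.2 ⟨fun h => hi (Finset.sdiff_subset h), Finset.disjoint_sdiff⟩
      rw [hsplit, labelSum_union hdisj, ← Finset.card_sdiff_of_subset hC.1,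
        ← ih C hC (fun h => hi (hC.1 h)) k₀, mul_comm, ← labelSum_const_mul]
      refine labelSum_congr fun k _ => ?_
      rw [labelSum_mul_of_agree (h := fun k => mergedCumulant (labelMoment P X k) {i} C),
        labelSum_labelMoment hX hb, mul_comm]
      intro k' hk'
      refine mergedCumulant_congr fun U hU => ?_
      unfold labelMoment
      congr 1
      funext ω
      refine Finset.prod_congr rfl fun x hx => ?_
      rw [hk' x (Finset.disjoint_left.1 hdisj (by rw [Finset.insert_eq]; exact hU hx))]
    have hcard : ∑ C ∈ B.ssubsets, cumulantSucc m C.card * m (B.card - C.card)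
        = ∑ j ∈ Finset.range B.card,
          (B.card.choose j : ℝ) * (cumulantSucc m j * m (B.card - j)) := by
      have := Finset.sum_powerset_apply_card
        (fun j => cumulantSucc m j * m (B.card - j)) (x := B)
      rw [hp, Finset.sum_insert (by simp), Finset.sum_range_succ, add_comm] at this
      simp only [nsmul_eq_mul, Nat.choose_self, Nat.cast_one, one_mul] at this
      exact add_right_cancel this
    calc labelSum (insert i B) (fun k => mergedCumulant (labelMoment P X k) {i} B) k₀
        = labelSum (insert i B) (fun k => labelMoment P X k (insert i B)) k₀
          - ∑ C ∈ B.ssubsets, labelSum (insert i B) (fun k =>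
            mergedCumulant (labelMoment P X k) {i} C * labelMoment P X k (B \ C)) k₀ := by
          rw [← labelSum_sum]
          unfold labelSum
          rw [← Finset.sum_sub_distrib]
          exact Finset.sum_congr rfl fun k _ => hlab k
      _ = cumulantSucc m B.card := by
          rw [labelSum_labelMoment hX hb, Finset.sum_congr rfl hterm, hcard,
            Finset.card_insert_of_notMem hi]
          conv_rhs => rw [cumulantSucc]
          rw [Fin.sum_univ_eq_sum_range
            (fun j => (B.card.choose j : ℝ) * (cumulantSucc m j * m (B.card - j)))]

end SumCumulants

/-! ### The bound for the cumulants of the sum -/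

section CumulantBound

variable {V Ω : Type*} [MeasurableSpace Ω]

open Classical in
/-- The number of spanning trees, grown from the root `i`, of the graph on the
positions in which two positions are joined if their labels interact. -/
noncomputable def labelTrees {ι : Type*} [Fintype ι] [DecidableEq ι] (G : Multigraph V)
    (k : ι → V) (i : ι) : ℝ :=
  forestSum (fun i j => if Interacts G (k i) (k j) then 1 else 0) {i} (Finset.univ.erase i)

variable {P : Measure Ω} {X : V → Ω → ℝ} {G : Multigraph V} {L : ℝ}

/-- The bound for the joint cumulants of `n + 1` members of the family, from any root. -/
theorem abs_mergedCumulant_labelMoment_le [IsProbabilityMeasure P] (hX : ∀ v, Measurable (X v))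
    (hb : ∀ v, ∀ᵐ ω ∂P, |X v ω| ≤ L) (hG : IsDependencyGraph P X G) {n : ℕ}
    (k : Fin (n + 1) → V) (i : Fin (n + 1)) :
    |mergedCumulant (labelMoment P X k) {0} (Finset.univ.erase 0)| ≤ 2 ^ n * labelTrees G k i *
      ∏ j, (∫ ω, |X (k j) ω| ^ (n + 1) ∂P) ^ (1 / ((n + 1 : ℕ) : ℝ)) := by
  classical
  have hroot : mergedCumulant (labelMoment P X k) {0} (Finset.univ.erase 0)
      = mergedCumulant (labelMoment P X k) {i} (Finset.univ.erase i) := by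
    rcases eq_or_ne i 0 with rfl | hi
    · rfl
    · have h1 : (Finset.univ.erase 0 : Finset (Fin (n + 1)))
          = insert i ((Finset.univ.erase 0).erase i) := by
        rw [Finset.insert_erase]; simp [hi]
      have h2 : (Finset.univ.erase i : Finset (Fin (n + 1)))
          = insert 0 ((Finset.univ.erase 0).erase i) := by
        rw [Finset.erase_right_comm, Finset.insert_erase]; simp [hi.symm]
      rw [h1, h2]
      exact mergedCumulant_singleton_comm (labelMoment_empty k) (by simp) (by simp)
  rw [hroot]
  have hdisj : Disjoint {i} (Finset.univ.erase i) := by simp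
  have hcard : (Finset.univ.erase i : Finset (Fin (n + 1))).card = n := by simp
  have huniv : ({i} ∪ Finset.univ.erase i : Finset (Fin (n + 1))) = Finset.univ := by
    ext; simp
  have := abs_mergedCumulant_le (M := labelMoment P X k) (labelMoment_empty k)
    (adj := fun i j => Interacts G (k i) (k j))
    (a := fun j => (∫ ω, |X (k j) ω| ^ (n + 1) ∂P) ^ (1 / ((n + 1 : ℕ) : ℝ)))
    (fun g B hgB h => labelMoment_union hX hG k hgB h)
    (fun g => abs_labelMoment_le hX hb k (Nat.succ_ne_zero n)
      ((Finset.card_le_univ g).trans_eq (by simp))) hdisj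
  rw [hcard, huniv] at this
  exact this

variable [Fintype V]

/-- The sum of the `r`-th absolute moments of the family. -/
noncomputable def absMoment (P : Measure Ω) (X : V → Ω → ℝ) (r : ℕ) : ℝ :=
  ∑ v, ∫ ω, |X v ω| ^ r ∂P

theorem absMoment_nonneg (P : Measure Ω) (X : V → Ω → ℝ) (r : ℕ) : 0 ≤ absMoment P X r :=
  Finset.sum_nonneg fun v _ => integral_nonneg fun ω => by positivity

/-- Since the estimate holds for every root, the arithmetic-geometric mean inequality may be
applied with the smallest tree count and each summand re-expanded from its own root. -/
theorem sum_abs_le_of_le_labelTrees {D n : ℕ}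
    (hD : maxDegree G ≤ D) {f : (Fin (n + 1) → V) → ℝ} {c : ℝ} (hc : 0 ≤ c)
    (hf : ∀ k i, |f k| ≤ c * labelTrees G k i *
      ∏ j, (∫ ω, |X (k j) ω| ^ (n + 1) ∂P) ^ (1 / ((n + 1 : ℕ) : ℝ))) :
    |∑ k, f k| ≤ c * ((n : ℝ) + 1) ^ (n - 1) * ((D : ℝ) + 1) ^ n * absMoment P X (n + 1) := by
  classical
  set A : V → ℝ := fun v => ∫ ω, |X v ω| ^ (n + 1) ∂P with hA_def
  have hA : ∀ v, 0 ≤ A v := fun v => integral_nonneg fun ω => by positivity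
  have hT : ∀ k i, 0 ≤ labelTrees G (k : Fin (n + 1) → V) i := fun k i =>
    forestSum_nonneg (fun _ _ => by split_ifs <;> norm_num) _ _
  have hn : (0 : ℝ) < (n : ℝ) + 1 := by positivity
  have hamgm : ∀ k : Fin (n + 1) → V, ∏ j, A (k j) ^ (1 / ((n + 1 : ℕ) : ℝ))
      ≤ ∑ i, 1 / ((n : ℝ) + 1) * A (k i) := by
    intro k
    have := Real.geom_mean_le_arith_mean_weighted Finset.univ
      (fun _ : Fin (n + 1) => 1 / ((n : ℝ) + 1)) (fun i => A (k i)) (fun _ _ => by positivity)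
      (by simp; field_simp) (fun i _ => hA _)
    simpa using this
  have hpt : ∀ k, |f k| ≤ ∑ i, c / ((n : ℝ) + 1) * (A (k i) * labelTrees G k i) := by
    intro k
    obtain ⟨i₀, _, hi₀⟩ := Finset.exists_min_image Finset.univ (labelTrees G k)
      Finset.univ_nonempty
    calc |f k| ≤ c * labelTrees G k i₀ * ∏ j, A (k j) ^ (1 / ((n + 1 : ℕ) : ℝ)) := hf k i₀
      _ ≤ c * labelTrees G k i₀ * ∑ i, 1 / ((n : ℝ) + 1) * A (k i) :=
          mul_le_mul_of_nonneg_left (hamgm k) (mul_nonneg hc (hT _ _))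
      _ = ∑ i, c / ((n : ℝ) + 1) * (A (k i) * labelTrees G k i₀) := by
          rw [Finset.mul_sum]
          exact Finset.sum_congr rfl fun i _ => by ring
      _ ≤ _ := Finset.sum_le_sum fun i hi => mul_le_mul_of_nonneg_left
          (mul_le_mul_of_nonneg_left (hi₀ i hi) (hA _)) (by positivity)
  have hroot : ∀ i, ∑ k : Fin (n + 1) → V, A (k i) * labelTrees G k i
      ≤ ((n : ℝ) + 1) ^ (n - 1) * ((D : ℝ) + 1) ^ n * ∑ v, A v := by
    intro i
    rcases isEmpty_or_nonempty V with hV | ⟨⟨v₀⟩⟩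
    · simp
    have hdisj : Disjoint {i} (Finset.univ.erase i) := by simp
    have hcard : (Finset.univ.erase i : Finset (Fin (n + 1))).card = n := by simp
    have huniv : ({i} ∪ Finset.univ.erase i : Finset (Fin (n + 1))) = Finset.univ := by
      ext; simp
    have hcount : forestCount 1 n = ((n : ℝ) + 1) ^ (n - 1) := by
      unfold forestCount
      split_ifs with h
      · simp [h]
      · push_cast; ring
    calc ∑ k : Fin (n + 1) → V, A (k i) * labelTrees G k i
        = labelSum {i} (labelSum (Finset.univ.erase i)
            fun k => A (k i) * labelTrees G k i) (fun _ => v₀) := by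
          rw [← labelSum_union hdisj, huniv, labelSum_univ]
      _ ≤ labelSum {i} (fun k => (((n : ℝ) + 1) ^ (n - 1) * ((D : ℝ) + 1) ^ n) * A (k i))
            (fun _ => v₀) := by
          refine labelSum_mono fun k _ => ?_
          rw [labelSum_mul_of_agree (h := fun k => A (k i)) fun k' hk' => by
            rw [hk' i (Finset.notMem_erase _ _)], mul_comm]
          refine mul_le_mul_of_nonneg_right ?_ (hA _)
          have := labelSum_forestSum_le (w := fun u v => if Interacts G u v then 1 else 0)
            (fun _ _ => by split_ifs <;> norm_num) (Δ := (D : ℝ) + 1)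
            (fun u => sum_interacts_le hD u) hdisj k
          rw [hcard, Finset.card_singleton, hcount] at this
          exact this
      _ = _ := by
          rw [labelSum_const_mul, labelSum_singleton]
          simp
  calc |∑ k, f k| ≤ ∑ k, |f k| := Finset.abs_sum_le_sum_abs _ _
    _ ≤ ∑ k : Fin (n + 1) → V, ∑ i, c / ((n : ℝ) + 1) * (A (k i) * labelTrees G k i) :=
        Finset.sum_le_sum fun k _ => hpt k
    _ = ∑ i, c / ((n : ℝ) + 1) * ∑ k : Fin (n + 1) → V, A (k i) * labelTrees G k i := by
        rw [Finset.sum_comm]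
        simp_rw [Finset.mul_sum]
    _ ≤ ∑ i : Fin (n + 1), c / ((n : ℝ) + 1) *
          (((n : ℝ) + 1) ^ (n - 1) * ((D : ℝ) + 1) ^ n * ∑ v, A v) :=
        Finset.sum_le_sum fun i _ => mul_le_mul_of_nonneg_left (hroot i) (by positivity)
    _ = _ := by
        rw [Finset.sum_const, Finset.card_univ, Fintype.card_fin, nsmul_eq_mul, absMoment]
        push_cast
        field_simp
        rfl

variable [IsProbabilityMeasure P]

theorem cumulantSucc_eq_sum (hX : ∀ v, Measurable (X v)) (hb : ∀ v, ∀ᵐ ω ∂P, |X v ω| ≤ L)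
    [Nonempty V] (n : ℕ) :
    cumulantSucc (fun n => ∫ ω, sumRV X ω ^ n ∂P) n
      = ∑ k : Fin (n + 1) → V, mergedCumulant (labelMoment P X k) {0} (Finset.univ.erase 0) := by
  have := labelSum_mergedCumulant (P := P) hX hb (i := (0 : Fin (n + 1)))
    (B := Finset.univ.erase 0) (by simp) (fun _ => Classical.arbitrary V)
  rw [Finset.insert_erase (Finset.mem_univ _), labelSum_univ] at this
  simpa using this.symm

/-- The cumulant of order `n + 1` of the sum is at most
`2 ^ n (n + 1) ^ (n - 1) (D + 1) ^ n ∑ v, E |X v| ^ (n + 1)`. -/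
theorem abs_cumulantSucc_le (hX : ∀ v, Measurable (X v)) (hb : ∀ v, ∀ᵐ ω ∂P, |X v ω| ≤ L)
    (hG : IsDependencyGraph P X G) {D : ℕ} (hD : maxDegree G ≤ D) [Nonempty V] (n : ℕ) :
    |cumulantSucc (fun n => ∫ ω, sumRV X ω ^ n ∂P) n|
      ≤ 2 ^ n * ((n : ℝ) + 1) ^ (n - 1) * ((D : ℝ) + 1) ^ n * absMoment P X (n + 1) := by
  rw [cumulantSucc_eq_sum hX hb]
  exact sum_abs_le_of_le_labelTrees hD (by positivity)
    fun k i => abs_mergedCumulant_labelMoment_le hX hb hG k i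

/-- For centred variables the third cumulant of the sum is a sum of plain moments, so that the
factors `2` attached to the edges disappear. -/
theorem abs_cumulantSucc_two_le_of_centred (hX : ∀ v, Measurable (X v))
    (hb : ∀ v, ∀ᵐ ω ∂P, |X v ω| ≤ L) (hG : IsDependencyGraph P X G) {D : ℕ}
    (hD : maxDegree G ≤ D) [Nonempty V] (h0 : ∀ v, ∫ ω, X v ω ∂P = 0) :
    |cumulantSucc (fun n => ∫ ω, sumRV X ω ^ n ∂P) 2|
      ≤ 3 * ((D : ℝ) + 1) ^ 2 * absMoment P X 3 := by
  classical
  rw [cumulantSucc_eq_sum hX hb]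
  have h := sum_abs_le_of_le_labelTrees (P := P) (X := X) hD zero_le_one
    (f := fun k : Fin 3 → V => mergedCumulant (labelMoment P X k) {0} (Finset.univ.erase 0))
    fun k i => ?_
  · refine h.trans (le_of_eq ?_)
    norm_num
  · have hbound := abs_mergedCumulant_labelMoment_le hX hb hG k i
    obtain ⟨N, hN⟩ : ∃ N : ℕ, labelTrees G k i = N :=
      exists_nat_eq_forestSum (fun i j => by split_ifs; exacts [⟨1, by simp⟩, ⟨0, by simp⟩]) _ _
    have hprod : 0 ≤ ∏ j, (∫ ω, |X (k j) ω| ^ (2 + 1) ∂P) ^ (1 / ((2 + 1 : ℕ) : ℝ)) :=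
      Finset.prod_nonneg fun j _ => Real.rpow_nonneg (integral_nonneg fun ω => by positivity) _
    rw [hN] at hbound ⊢
    -- Without a spanning tree the cumulant vanishes; otherwise the tree count is at least `1`.
    rcases Nat.eq_zero_or_pos N with rfl | hNpos
    · simpa using hbound
    · have hM1 : ∀ j, labelMoment P X k {j} = 0 := fun j => by simp [labelMoment, h0]
      have hM0 := labelMoment_empty (P := P) (X := X) k
      have he : ∀ j, mergedCumulant (labelMoment P X k) {j} ∅ = 0 := fun j => by
        rw [mergedCumulant_empty hM0, hM1]
      have hpow : ({2} : Finset (Fin 3)).powerset = {∅, {2}} := by decide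
      have hset : (Finset.univ.erase 0 : Finset (Fin 3)) = insert 1 {2} := by decide
      have hκ : mergedCumulant (labelMoment P X k) {0} (Finset.univ.erase 0)
          = labelMoment P X k Finset.univ := by
        have h2 := moment_eq_sum_mergedCumulant hM0 {1, 0} {2}
        have huniv : ({1, 0} ∪ {2} : Finset (Fin 3)) = Finset.univ := by decide
        rw [huniv, hpow, Finset.sum_pair (by decide)] at h2
        simp only [Finset.sdiff_empty, hM1, mul_zero, zero_add, Finset.sdiff_self, hM0,
          mul_one] at h2
        rw [hset, mergedCumulant_insert hM0 _ _ (by decide), hpow,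
          Finset.sum_pair (by decide)]
        simp [he, h2]
      rw [hκ]
      have h3 := abs_labelMoment_le (P := P) hX hb k (r := 2 + 1) (by norm_num)
        (U := Finset.univ) (by simp)
      refine h3.trans (le_mul_of_one_le_left hprod ?_)
      rw [one_mul]
      exact_mod_cast hNpos

end CumulantBound

/-! ### The characteristic function as the exponential of the cumulant series -/

section CumulantSeries

open scoped Nat

variable {Ω : Type*} [MeasurableSpace Ω] {P : Measure Ω} [IsProbabilityMeasure P]
  {S : Ω → ℝ} {K : ℝ}

theorem nonneg_of_ae_abs_le (hb : ∀ᵐ ω ∂P, |S ω| ≤ K) : 0 ≤ K := by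
  obtain ⟨ω, hω⟩ := hb.exists
  exact (abs_nonneg _).trans hω

theorem integrable_pow_of_ae_abs_le (hS : Measurable S) (hb : ∀ᵐ ω ∂P, |S ω| ≤ K) (n : ℕ) :
    Integrable (fun ω => S ω ^ n) P := by
  refine Integrable.of_bound (hS.pow_const n).aestronglyMeasurable (K ^ n) ?_
  filter_upwards [hb] with ω hω
  rw [norm_pow, Real.norm_eq_abs]
  exact pow_le_pow_left₀ (abs_nonneg _) hω n

theorem abs_integral_pow_le (hb : ∀ᵐ ω ∂P, |S ω| ≤ K) (n : ℕ) :
    |∫ ω, S ω ^ n ∂P| ≤ K ^ n := by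
  have h := norm_integral_le_of_norm_le_const (μ := P) (f := fun ω => S ω ^ n) (C := K ^ n) ?_
  · simpa using h
  · filter_upwards [hb] with ω hω
    rw [norm_pow, Real.norm_eq_abs]
    exact pow_le_pow_left₀ (abs_nonneg _) hω n

theorem summable_moment_div_factorial (hb : ∀ᵐ ω ∂P, |S ω| ≤ K) (z : ℂ) (j : ℕ) :
    Summable fun n : ℕ => ‖((∫ ω, S ω ^ (n + j) ∂P : ℝ) : ℂ) * (z ^ n / n !)‖ := by
  have hK := nonneg_of_ae_abs_le hb
  refine Summable.of_nonneg_of_le (fun _ => norm_nonneg _) (fun n => ?_)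
    ((Real.summable_pow_div_factorial (K * ‖z‖)).mul_left (K ^ j))
  rw [norm_mul, norm_div, norm_pow, Complex.norm_real, Complex.norm_natCast, Real.norm_eq_abs]
  calc |∫ ω, S ω ^ (n + j) ∂P| * (‖z‖ ^ n / n !) ≤ K ^ (n + j) * (‖z‖ ^ n / n !) :=
        mul_le_mul_of_nonneg_right (abs_integral_pow_le hb _) (by positivity)
    _ = K ^ j * ((K * ‖z‖) ^ n / n !) := by rw [mul_pow, pow_add]; ring

theorem hasSum_integral_pow_mul_exp (hS : Measurable S) (hb : ∀ᵐ ω ∂P, |S ω| ≤ K) (z : ℂ)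
    (j : ℕ) :
    HasSum (fun n : ℕ => ((∫ ω, S ω ^ (n + j) ∂P : ℝ) : ℂ) * (z ^ n / n !))
      (∫ ω, (S ω : ℂ) ^ j * Complex.exp (z * S ω) ∂P) := by
  have hK := nonneg_of_ae_abs_le hb
  have hint : ∀ n : ℕ, Integrable (fun ω => ((S ω ^ (n + j) : ℝ) : ℂ) * (z ^ n / n !)) P :=
    fun n => (integrable_pow_of_ae_abs_le hS hb (n + j)).ofReal.mul_const _
  have hF : ∀ n : ℕ, ∫ ω, ((S ω ^ (n + j) : ℝ) : ℂ) * (z ^ n / n !) ∂P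
      = ((∫ ω, S ω ^ (n + j) ∂P : ℝ) : ℂ) * (z ^ n / n !) := fun n => by
    rw [integral_mul_const, integral_complex_ofReal]
  have hsum : Summable fun n : ℕ =>
      ∫ ω, ‖((S ω ^ (n + j) : ℝ) : ℂ) * (z ^ n / n !)‖ ∂P := by
    refine Summable.of_nonneg_of_le (fun n => integral_nonneg fun _ => norm_nonneg _)
      (fun n => ?_) ((Real.summable_pow_div_factorial (K * ‖z‖)).mul_left (K ^ j))
    calc ∫ ω, ‖((S ω ^ (n + j) : ℝ) : ℂ) * (z ^ n / n !)‖ ∂P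
        ≤ ∫ _, K ^ j * ((K * ‖z‖) ^ n / n !) ∂P := by
          refine integral_mono_ae (hint n).norm (integrable_const _) ?_
          filter_upwards [hb] with ω hω
          rw [norm_mul, norm_div, norm_pow, Complex.norm_real, Complex.norm_natCast, norm_pow,
            Real.norm_eq_abs]
          calc |S ω| ^ (n + j) * (‖z‖ ^ n / n !) ≤ K ^ (n + j) * (‖z‖ ^ n / n !) := by gcongr
            _ = K ^ j * ((K * ‖z‖) ^ n / n !) := by rw [mul_pow, pow_add]; ring
      _ = _ := by simp
  have h := hasSum_integral_of_summable_integral_norm hint hsum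
  simp_rw [hF] at h
  have hexp : ∫ ω, (S ω : ℂ) ^ j * Complex.exp (z * S ω) ∂P
      = ∫ ω, ∑' n : ℕ, ((S ω ^ (n + j) : ℝ) : ℂ) * (z ^ n / n !) ∂P := by
    refine integral_congr_ae (Filter.Eventually.of_forall fun ω => ?_)
    have he := NormedSpace.expSeries_div_hasSum_exp (z * S ω)
    rw [← Complex.exp_eq_exp_ℂ] at he
    have he' := he.mul_left ((S ω : ℂ) ^ j)
    simp only
    rw [← he'.tsum_eq]
    refine tsum_congr fun n => ?_
    push_cast
    rw [mul_pow, pow_add]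
    ring
  rw [hexp]
  exact h

/-- If the cumulant series has radius of convergence at least `R`, the exponential moments are
its exponential on the disc of radius `R`: both sides solve the same differential equation,
by the recursion between moments and cumulants. -/
theorem integral_exp_eq_exp_cumulant_series (hS : Measurable S) (hb : ∀ᵐ ω ∂P, |S ω| ≤ K)
    {R : ℝ} (hR : ∀ r, 0 ≤ r → r < R →
      Summable fun n : ℕ => |cumulantSucc (fun n => ∫ ω, S ω ^ n ∂P) n| * (r ^ n / n !))
    {z : ℂ} (hz : ‖z‖ < R) :
    ∫ ω, Complex.exp (z * S ω) ∂P = Complex.exp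
      (∑' n : ℕ, (cumulantSucc (fun n => ∫ ω, S ω ^ n ∂P) n : ℂ) * (z ^ (n + 1) / (n + 1)!)) := by
  set m : ℕ → ℝ := fun n => ∫ ω, S ω ^ n ∂P with hm_def
  set κ := cumulantSucc m with hκ
  have hm0 : m 0 = 1 := by simp [hm_def]
  -- On a slightly smaller disc the differentiated series converges uniformly.
  obtain ⟨r, hzr, hrR⟩ := exists_between hz
  have hr0 : 0 < r := (norm_nonneg z).trans_lt hzr
  have hball : ∀ {y : ℂ}, y ∈ Metric.ball (0 : ℂ) r → ‖y‖ < r := fun hy => by simpa using hy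
  have hterm : ∀ (n : ℕ) (y : ℂ), y ∈ Metric.ball (0 : ℂ) r →
      ‖(κ n : ℂ) * (y ^ n / n !)‖ ≤ |κ n| * (r ^ n / n !) := by
    intro n y hy
    rw [norm_mul, norm_div, norm_pow, Complex.norm_real, Complex.norm_natCast, Real.norm_eq_abs]
    have := (hball hy).le
    gcongr
  have hKderiv : ∀ y ∈ Metric.ball (0 : ℂ) r,
      HasDerivAt (fun w : ℂ => ∑' n : ℕ, (κ n : ℂ) * (w ^ (n + 1) / (n + 1)!))
        (∑' n : ℕ, (κ n : ℂ) * (y ^ n / n !)) y := by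
    intro y hy
    refine hasDerivAt_tsum_of_isPreconnected (hR r hr0.le hrR) Metric.isOpen_ball
      (convex_ball _ _).isPreconnected (fun n w _ => ?_) hterm
      (Metric.mem_ball_self hr0) (by simp) hy
    have h := ((hasDerivAt_pow (n + 1) w).div_const ((n + 1)! : ℂ)).const_mul (κ n : ℂ)
    refine h.congr_deriv ?_
    rw [Nat.factorial_succ]
    push_cast
    have : (n : ℂ) + 1 ≠ 0 := Nat.cast_add_one_ne_zero n
    have : (n ! : ℂ) ≠ 0 := by exact_mod_cast Nat.factorial_ne_zero n
    field_simp
  have hprod : ∀ y ∈ Metric.ball (0 : ℂ) r,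
      ∫ ω, (S ω : ℂ) * Complex.exp (y * S ω) ∂P
        = (∑' n : ℕ, (κ n : ℂ) * (y ^ n / n !)) * ∫ ω, Complex.exp (y * S ω) ∂P := by
    intro y hy
    have h0 := hasSum_integral_pow_mul_exp hS hb y 0
    have h1 := hasSum_integral_pow_mul_exp hS hb y 1
    simp only [pow_zero, one_mul, pow_one, add_zero] at h0 h1
    rw [← h0.tsum_eq, ← h1.tsum_eq, tsum_mul_tsum_eq_tsum_sum_range_of_summable_norm
      ((hR r hr0.le hrR).of_nonneg_of_le (fun _ => norm_nonneg _) fun n => hterm n y hy)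
      (by simpa using summable_moment_div_factorial hb y 0)]
    refine tsum_congr fun n => ?_
    have := moment_succ_eq m hm0 n
    simp only [hm_def] at this
    rw [this]
    push_cast
    rw [Finset.sum_mul]
    refine Finset.sum_congr rfl fun j hj => ?_
    have hj' : j ≤ n := Nat.lt_succ_iff.1 (Finset.mem_range.1 hj)
    rw [Nat.cast_choose ℂ hj', ← Nat.add_sub_of_le hj', pow_add]
    have h2 : (n ! : ℂ) ≠ 0 := by exact_mod_cast Nat.factorial_ne_zero n
    have h3 : (j ! : ℂ) ≠ 0 := by exact_mod_cast Nat.factorial_ne_zero j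
    have h4 : ((n - j)! : ℂ) ≠ 0 := by exact_mod_cast Nat.factorial_ne_zero (n - j)
    simp only [Nat.add_sub_of_le hj']
    field_simp
    simp [hκ, hm_def]
    ring
  have hMderiv : ∀ y : ℂ, HasDerivAt (fun w : ℂ => ∫ ω, Complex.exp (w * S ω) ∂P)
      (∫ ω, (S ω : ℂ) * Complex.exp (y * S ω) ∂P) y := by
    intro y
    refine hasDerivAt_complexMGF (X := S) (μ := P) ?_
    have : integrableExpSet S P = Set.univ := by
      refine Set.eq_univ_of_forall fun t => ?_
      refine integrable_exp_mul_of_mem_Icc (a := -K) (b := K) hS.aemeasurable ?_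
      filter_upwards [hb] with ω hω
      exact abs_le.1 hω
    rw [this, interior_univ]
    exact Set.mem_univ _
  set Φ : ℂ → ℂ := fun w => ∑' n : ℕ, (κ n : ℂ) * (w ^ (n + 1) / (n + 1)!) with hΦ
  have hquot : ∀ y ∈ Metric.ball (0 : ℂ) r,
      HasDerivAt (fun w => (∫ ω, Complex.exp (w * S ω) ∂P) * Complex.exp (-Φ w)) 0 y := by
    intro y hy
    have := (hMderiv y).mul (hKderiv y hy).neg.cexp
    refine this.congr_deriv ?_
    rw [hprod y hy]
    ring
  have hconst := Metric.isOpen_ball.is_const_of_deriv_eq_zero (convex_ball (0 : ℂ) r).isPreconnected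
    (fun y hy => (hquot y hy).differentiableAt.differentiableWithinAt)
    (fun y hy => (hquot y hy).deriv) (x := z) (y := 0) (by simpa using hzr)
    (Metric.mem_ball_self hr0)
  have hΦ0 : Φ 0 = 0 := by simp [hΦ]
  simp only [hΦ0, neg_zero, Complex.exp_zero, zero_mul, integral_const, probReal_univ, one_smul,
    mul_one] at hconst
  rw [Complex.exp_neg] at hconst
  exact (mul_inv_eq_one₀ (Complex.exp_ne_zero _)).1 hconst

end CumulantSeries

/-! ### A bound for the tail of the cumulant series -/

section Tail

open scoped Nat

/-- The coefficients of the tail of the cumulant series at the radius of convergence. -/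
noncomputable def tailCoeff (n : ℕ) : ℝ :=
  8 * ((n : ℝ) + 4) ^ (n + 2) / (n + 4)! * Real.exp (-n)

theorem tailCoeff_nonneg (n : ℕ) : 0 ≤ tailCoeff n := by
  unfold tailCoeff; positivity

/-- Stirling's lower bound for the factorial makes the coefficients decay like
`n ^ (-5 / 2)`; for `n ≥ 6`, half a power is replaced by the constant `√10`. -/
theorem tailCoeff_le_of_six_le (n : ℕ) :
    tailCoeff (n + 6) ≤ 56 * (1 / ((n : ℝ) + 9.5) - 1 / ((n : ℝ) + 10.5)) := by
  have hst := Stirling.le_factorial_stirling (n + 10)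
  set r : ℝ := (n : ℝ) + 10 with hr
  have hr10 : 10 ≤ r := by simp [hr]
  have hr0 : 0 < r := by linarith
  have hpush : ((n + 10 : ℕ) : ℝ) = r := by rw [hr]; push_cast; ring
  rw [hpush] at hst
  have hsqrt : 7.9 ≤ √(2 * Real.pi * r) := by
    apply Real.le_sqrt_of_sq_le
    nlinarith [Real.pi_gt_d4]
  have hfac : 7.9 * (r / Real.exp 1) ^ (n + 10) ≤ ((n + 10)! : ℝ) :=
    (mul_le_mul_of_nonneg_right hsqrt (by positivity)).trans hst
  have hfpos : (0 : ℝ) < (n + 10)! := by positivity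
  have he4 : Real.exp 4 ≤ 54.6 := by
    have h := Real.exp_one_lt_d9
    have h4 : Real.exp 4 = Real.exp 1 ^ 4 := by rw [← Real.exp_nat_mul]; norm_num
    rw [h4]
    calc Real.exp 1 ^ 4 ≤ 2.7182818286 ^ 4 := by gcongr
      _ ≤ 54.6 := by norm_num
  have h1 : tailCoeff (n + 6) ≤ 8 * Real.exp 4 / (7.9 * r ^ 2) := by
    unfold tailCoeff
    have hc : (((n + 6 : ℕ) : ℝ) + 4) = r := by rw [hr]; push_cast; ring
    rw [hc, show n + 6 + 4 = n + 10 by ring, show n + 6 + 2 = n + 8 by ring,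
      div_mul_eq_mul_div, div_le_div_iff₀ hfpos (by positivity)]
    have hexp : Real.exp (-((n + 6 : ℕ) : ℝ)) = Real.exp 4 / Real.exp 1 ^ (n + 10) := by
      rw [← Real.exp_nat_mul, ← Real.exp_sub]
      congr 1; push_cast; ring
    rw [hexp]
    calc 8 * r ^ (n + 8) * (Real.exp 4 / Real.exp 1 ^ (n + 10)) * (7.9 * r ^ 2)
        = 8 * Real.exp 4 * (7.9 * (r / Real.exp 1) ^ (n + 10)) := by
          rw [div_pow]; ring
      _ ≤ _ := mul_le_mul_of_nonneg_left hfac (by positivity)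
  refine h1.trans ?_
  have h2 : 1 / ((n : ℝ) + 9.5) - 1 / ((n : ℝ) + 10.5) = 1 / (r ^ 2 - 0.25) := by
    rw [hr]
    have : (n : ℝ) + 9.5 ≠ 0 := by positivity
    have : (n : ℝ) + 10.5 ≠ 0 := by positivity
    have : ((n : ℝ) + 10) ^ 2 - 0.25 ≠ 0 := by nlinarith
    field_simp
    ring
  have h3 : 0 < r ^ 2 - 0.25 := by nlinarith
  rw [h2, ← mul_div_assoc, mul_one, div_le_div_iff₀ (by positivity) h3]
  nlinarith

theorem sum_tailCoeff_le (N : ℕ) : ∑ n ∈ Finset.range N, tailCoeff n ≤ 19.5 := by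
  have he := Real.exp_one_gt_d9
  -- Six terms are evaluated; the others telescope.
  have hfirst : ∑ n ∈ Finset.range 6, tailCoeff n ≤ 13.5 := by
    have hpow : ∀ n : ℕ, Real.exp (-(n : ℝ)) ≤ 1 / 2.718 ^ n := by
      intro n
      rw [Real.exp_neg, ← one_div, show (n : ℝ) = n * 1 by ring, Real.exp_nat_mul]
      gcongr
      linarith
    have h : ∀ n : ℕ, tailCoeff n ≤ 8 * ((n : ℝ) + 4) ^ (n + 2) / (n + 4)! * (1 / 2.718 ^ n) :=
      fun n => mul_le_mul_of_nonneg_left (hpow n) (by positivity)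
    refine (Finset.sum_le_sum fun n _ => h n).trans ?_
    simp only [Finset.sum_range_succ, Finset.sum_range_zero, Nat.factorial]
    norm_num
  have hind : ∀ N : ℕ, ∑ n ∈ Finset.range (N + 6), tailCoeff n
      ≤ 13.5 + 56 * (1 / 9.5 - 1 / ((N : ℝ) + 9.5)) := by
    intro N
    induction N with
    | zero => simpa using hfirst
    | succ N ih =>
      rw [show N + 1 + 6 = (N + 6) + 1 by ring, Finset.sum_range_succ]
      have := tailCoeff_le_of_six_le N
      push_cast
      have e : (N : ℝ) + 1 + 9.5 = N + 10.5 := by ring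
      rw [e]
      linarith
  calc ∑ n ∈ Finset.range N, tailCoeff n ≤ ∑ n ∈ Finset.range (N + 6), tailCoeff n :=
        Finset.sum_le_sum_of_subset_of_nonneg (Finset.range_mono (by omega))
          fun n _ _ => tailCoeff_nonneg n
    _ ≤ 13.5 + 56 * (1 / 9.5 - 1 / ((N : ℝ) + 9.5)) := hind N
    _ ≤ 19.5 := by
        have h0 : 0 ≤ 1 / ((N : ℝ) + 9.5) := by positivity
        have h1 : (13.5 : ℝ) + 56 * (1 / 9.5) ≤ 19.5 := by norm_num
        linarith

theorem summable_tailCoeff : Summable tailCoeff :=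
  summable_of_sum_range_le tailCoeff_nonneg sum_tailCoeff_le

theorem tsum_tailCoeff_le : ∑' n, tailCoeff n ≤ 19.5 :=
  Real.tsum_le_of_sum_range_le tailCoeff_nonneg sum_tailCoeff_le

end Tail

/-! ### The characteristic function of the normalized sum -/

section CharFun

open scoped Nat

variable {V Ω : Type*} [Fintype V] [MeasurableSpace Ω] {P : Measure Ω}
  {X : V → Ω → ℝ} {G : Multigraph V} {L : ℝ}

theorem measurable_sumRV (hX : ∀ v, Measurable (X v)) : Measurable (sumRV X) :=
  Finset.measurable_sum _ fun v _ => hX v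

theorem ae_abs_sumRV_le (hb : ∀ v, ∀ᵐ ω ∂P, |X v ω| ≤ L) :
    ∀ᵐ ω ∂P, |sumRV X ω| ≤ Fintype.card V * L := by
  filter_upwards [ae_all_iff.2 hb] with ω hω
  refine (Finset.abs_sum_le_sum_abs _ _).trans ((Finset.sum_le_sum fun v _ => hω v).trans ?_)
  simp

variable [IsProbabilityMeasure P]

theorem absMoment_add_le (hX : ∀ v, Measurable (X v)) (hb : ∀ v, ∀ᵐ ω ∂P, |X v ω| ≤ L)
    (j n : ℕ) : absMoment P X (n + j) ≤ L ^ n * absMoment P X j := by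
  unfold absMoment
  rw [Finset.mul_sum]
  refine Finset.sum_le_sum fun v _ => ?_
  have hint : ∀ r : ℕ, Integrable (fun ω => |X v ω| ^ r) P := fun r => by
    refine Integrable.of_bound ((hX v).abs.pow_const r).aestronglyMeasurable (L ^ r) ?_
    filter_upwards [hb v] with ω hω
    rw [norm_pow, Real.norm_eq_abs, abs_abs]
    exact pow_le_pow_left₀ (abs_nonneg _) hω r
  rw [← integral_const_mul]
  refine integral_mono_ae (hint _) ((hint j).const_mul _) ?_
  filter_upwards [hb v] with ω hω
  rw [pow_add]
  exact mul_le_mul_of_nonneg_right (pow_le_pow_left₀ (abs_nonneg _) hω n) (by positivity)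

theorem cumulantSucc_zero (m : ℕ → ℝ) : cumulantSucc m 0 = m 1 := by
  rw [cumulantSucc]; simp

theorem cumulantSucc_one (m : ℕ → ℝ) : cumulantSucc m 1 = m 2 - m 1 ^ 2 := by
  rw [cumulantSucc]; simp [cumulantSucc_zero]; ring

theorem cumulantSucc_two (m : ℕ → ℝ) :
    cumulantSucc m 2 = m 3 - 3 * m 1 * m 2 + 2 * m 1 ^ 3 := by
  rw [cumulantSucc, Fin.sum_univ_two]
  simp [cumulantSucc_zero, cumulantSucc_one]; ring

theorem cumulantSucc_one_eq_variance {S : Ω → ℝ} {K : ℝ} (hS : Measurable S)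
    (hb : ∀ᵐ ω ∂P, |S ω| ≤ K) :
    cumulantSucc (fun n => ∫ ω, S ω ^ n ∂P) 1 = variance S P := by
  rw [cumulantSucc_one, variance_eq_sub (MemLp.of_bound hS.aestronglyMeasurable K hb)]
  simp

theorem cumulantSucc_two_eq_integral {S : Ω → ℝ} {K : ℝ} (hS : Measurable S)
    (hb : ∀ᵐ ω ∂P, |S ω| ≤ K) :
    cumulantSucc (fun n => ∫ ω, S ω ^ n ∂P) 2 = ∫ ω, (S ω - ∫ ω', S ω' ∂P) ^ 3 ∂P := by
  set a := ∫ ω', S ω' ∂P with ha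
  have hint := integrable_pow_of_ae_abs_le (P := P) hS hb
  have h1 := hint 1
  simp only [pow_one] at h1
  have h : ∀ ω, (S ω - a) ^ 3 = S ω ^ 3 - (3 * a * S ω ^ 2 - 3 * a ^ 2 * S ω + a ^ 3) :=
    fun ω => by ring
  have hi2 : Integrable (fun ω => 3 * a * S ω ^ 2) P := (hint 2).const_mul _
  have hi1 : Integrable (fun ω => 3 * a ^ 2 * S ω) P := h1.const_mul _
  have hi21 : Integrable (fun ω => 3 * a * S ω ^ 2 - 3 * a ^ 2 * S ω) P := hi2.sub hi1
  have hi : Integrable (fun ω => 3 * a * S ω ^ 2 - 3 * a ^ 2 * S ω + a ^ 3) P :=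
    hi21.add (integrable_const _)
  simp_rw [h]
  rw [integral_sub (hint 3) hi, integral_add hi21 (integrable_const _), integral_sub hi2 hi1,
    integral_const_mul, integral_const_mul, cumulantSucc_two]
  simp [← ha]
  ring

/-- Within the radius of convergence of the cumulant series, the characteristic function of the
normalized sum is Gaussian up to the contributions of the third cumulant and of the tail. -/
theorem exists_charFun_eq_exp (hX : ∀ v, Measurable (X v)) (hb : ∀ v, ∀ᵐ ω ∂P, |X v ω| ≤ L)
    (hL : 0 < L) (hG : IsDependencyGraph P X G) {D : ℕ} (hD : maxDegree G ≤ D) [Nonempty V]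
    (hv : 0 < stdDev P X) {t : ℝ}
    (ht : |t| / stdDev P X * (2 * Real.exp 1 * (((D : ℝ) + 1) * L)) < 1) :
    ∃ E : ℂ, ‖E‖ ≤ rho P X / stdDev P X ^ 3 * |t| ^ 3 / 6
        + 19.5 * (((D : ℝ) + 1) ^ 3 * absMoment P X 4 / stdDev P X ^ 4) * t ^ 4 ∧
      charFun (P.map (normalizedSum P X)) t = Complex.exp (-(t ^ 2 / 2 : ℝ) + E) := by
  set v := stdDev P X with hv_def
  set Δ : ℝ := (D : ℝ) + 1 with hΔ
  have hΔ0 : 0 < Δ := by positivity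
  have he0 := Real.exp_pos 1
  set S := sumRV X with hS_def
  have hS : Measurable S := measurable_sumRV hX
  have hSb := ae_abs_sumRV_le (P := P) hb
  set m : ℕ → ℝ := fun n => ∫ ω, S ω ^ n ∂P with hm
  set κ := cumulantSucc m with hκ
  have hκle : ∀ n, |κ n| ≤ 2 ^ n * ((n : ℝ) + 1) ^ (n - 1) * Δ ^ n * absMoment P X (n + 1) :=
    fun n => abs_cumulantSucc_le hX hb hG hD n
  set R : ℝ := 1 / (2 * Real.exp 1 * (Δ * L)) with hR_def
  have hconv : ∀ r, 0 ≤ r → r < R → Summable fun n : ℕ => |κ n| * (r ^ n / n !) := by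
    intro r hr0 hrR
    rw [hR_def, lt_div_iff₀ (by positivity)] at hrR
    set q := r * (2 * Real.exp 1 * (Δ * L)) with hq
    have hq0 : 0 ≤ q := by positivity
    refine Summable.of_nonneg_of_le (fun n => by positivity) (fun n => ?_)
      ((summable_geometric_of_lt_one hq0 hrR).mul_left (Real.exp 1 * absMoment P X 1))
    have hA := absMoment_add_le (P := P) hX hb 1 n
    have hA1 := absMoment_nonneg P X 1
    have hpow : ((n : ℝ) + 1) ^ (n - 1) / n ! ≤ Real.exp 1 ^ (n + 1) := by
      calc ((n : ℝ) + 1) ^ (n - 1) / n ! ≤ ((n : ℝ) + 1) ^ n / n ! := by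
            gcongr
            · linarith [(Nat.cast_nonneg n : (0 : ℝ) ≤ n)]
            · omega
        _ = ((n : ℝ) + 1) ^ (n + 1) / (n + 1)! := by
            rw [Nat.factorial_succ]; push_cast; field_simp; ring
        _ ≤ Real.exp ((n : ℝ) + 1) := Real.pow_div_factorial_le_exp _ (by positivity) _
        _ = Real.exp 1 ^ (n + 1) := by rw [← Real.exp_nat_mul]; push_cast; ring_nf
    calc |κ n| * (r ^ n / n !)
        ≤ 2 ^ n * ((n : ℝ) + 1) ^ (n - 1) * Δ ^ n * (L ^ n * absMoment P X 1) * (r ^ n / n !) := by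
          refine mul_le_mul_of_nonneg_right ((hκle n).trans ?_) (by positivity)
          exact mul_le_mul_of_nonneg_left hA (by positivity)
      _ = (2 ^ n * Δ ^ n * L ^ n * r ^ n * absMoment P X 1) * (((n : ℝ) + 1) ^ (n - 1) / n !) := by
          ring
      _ ≤ (2 ^ n * Δ ^ n * L ^ n * r ^ n * absMoment P X 1) * Real.exp 1 ^ (n + 1) :=
          mul_le_mul_of_nonneg_left hpow (by positivity)
      _ = Real.exp 1 * absMoment P X 1 * q ^ n := by
          rw [hq]; simp only [mul_pow]; ring
  -- The term `a 0` below is removed by centring and `a 1` is the Gaussian exponent.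
  set z : ℂ := ((t / v : ℝ) : ℂ) * Complex.I with hz
  have hznorm : ‖z‖ = |t| / v := by
    rw [hz, norm_mul, Complex.norm_I, mul_one, Complex.norm_real, Real.norm_eq_abs, abs_div,
      abs_of_pos hv]
  have hzR : ‖z‖ < R := by
    rw [hznorm, hR_def, lt_div_iff₀ (by positivity)]
    exact ht
  have hmain := integral_exp_eq_exp_cumulant_series hS hSb hconv hzR
  set a : ℕ → ℂ := fun n => (κ n : ℂ) * (z ^ (n + 1) / (n + 1)!) with ha
  have htail : ∀ n, ‖a (n + 3)‖
      ≤ (Δ ^ 3 * absMoment P X 4 * ‖z‖ ^ 4) * tailCoeff n := by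
    intro n
    have hA := absMoment_add_le (P := P) hX hb 4 n
    have hA4 := absMoment_nonneg P X 4
    have hzsmall : 2 * Δ * L * ‖z‖ ≤ 1 / Real.exp 1 := by
      rw [le_div_iff₀ he0, hznorm]
      calc 2 * Δ * L * (|t| / v) * Real.exp 1
          = |t| / v * (2 * Real.exp 1 * (Δ * L)) := by ring
        _ ≤ 1 := ht.le
    have hκn := hκle (n + 3)
    rw [show n + 3 + 1 = n + 4 by ring, show n + 3 - 1 = n + 2 by omega] at hκn
    have hcast : (((n + 3 : ℕ) : ℝ) + 1) = (n : ℝ) + 4 := by push_cast; ring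
    rw [hcast] at hκn
    rw [ha]
    simp only
    rw [norm_mul, norm_div, norm_pow, Complex.norm_real, Complex.norm_natCast, Real.norm_eq_abs,
      show n + 3 + 1 = n + 4 by ring]
    calc |κ (n + 3)| * (‖z‖ ^ (n + 4) / (n + 4)!)
        ≤ 2 ^ (n + 3) * ((n : ℝ) + 4) ^ (n + 2) * Δ ^ (n + 3) * (L ^ n * absMoment P X 4)
            * (‖z‖ ^ (n + 4) / (n + 4)!) := by
          refine mul_le_mul_of_nonneg_right (hκn.trans ?_) (by positivity)
          exact mul_le_mul_of_nonneg_left hA (by positivity)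
      _ = (Δ ^ 3 * absMoment P X 4 * ‖z‖ ^ 4) * (8 * ((n : ℝ) + 4) ^ (n + 2) / (n + 4)!)
            * (2 * Δ * L * ‖z‖) ^ n := by
          simp only [mul_pow, pow_add]; ring
      _ ≤ (Δ ^ 3 * absMoment P X 4 * ‖z‖ ^ 4) * (8 * ((n : ℝ) + 4) ^ (n + 2) / (n + 4)!)
            * (1 / Real.exp 1) ^ n := by
          refine mul_le_mul_of_nonneg_left ?_ (by positivity)
          exact pow_le_pow_left₀ (by positivity) hzsmall n
      _ = _ := by
          rw [tailCoeff, Real.exp_neg, one_div, inv_pow, ← Real.exp_nat_mul, mul_one]; ring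
  have hsum3 : Summable fun n => a (n + 3) :=
    Summable.of_norm_bounded (summable_tailCoeff.mul_left _) htail
  have hsum : Summable a := (summable_nat_add_iff 3).1 hsum3
  have hsplit := hsum.sum_add_tsum_nat_add 3
  have hE : ‖∑' n, a (n + 3)‖ ≤ 19.5 * (Δ ^ 3 * absMoment P X 4 / v ^ 4) * t ^ 4 := by
    calc ‖∑' n, a (n + 3)‖ ≤ ∑' n, (Δ ^ 3 * absMoment P X 4 * ‖z‖ ^ 4) * tailCoeff n :=
          tsum_of_norm_bounded (summable_tailCoeff.mul_left _).hasSum htail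
      _ = (Δ ^ 3 * absMoment P X 4 * ‖z‖ ^ 4) * ∑' n, tailCoeff n := tsum_mul_left
      _ ≤ (Δ ^ 3 * absMoment P X 4 * ‖z‖ ^ 4) * 19.5 := by
          have := absMoment_nonneg P X 4
          exact mul_le_mul_of_nonneg_left tsum_tailCoeff_le (by positivity)
      _ = _ := by
          rw [hznorm, div_pow, Even.pow_abs (by decide)]; ring
  refine ⟨a 2 + ∑' n, a (n + 3), ?_, ?_⟩
  · refine (norm_add_le _ _).trans (add_le_add (le_of_eq ?_) hE)
    rw [ha]
    simp only
    rw [norm_mul, norm_div, norm_pow, Complex.norm_real, Complex.norm_natCast, Real.norm_eq_abs,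
      hznorm, hκ, cumulantSucc_two_eq_integral hS hSb, rho, div_pow]
    simp [Nat.factorial]
    ring
  · have hvar : κ 1 = v ^ 2 := by
      rw [hκ, cumulantSucc_one_eq_variance hS hSb, hv_def, stdDev,
        Real.sq_sqrt (variance_nonneg _ _)]
    have ha0 : a 0 = (m 1 : ℂ) * z := by
      simp [ha, hκ, cumulantSucc_zero]
    have ha1 : a 1 = -(t ^ 2 / 2 : ℝ) := by
      have hvc : (v : ℂ) ≠ 0 := by exact_mod_cast hv.ne'
      simp only [ha, hvar, hz, mul_pow]
      push_cast
      simp [Nat.factorial, Complex.I_sq]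
      field_simp
    have hW : Measurable (normalizedSum P X) := (hS.sub_const _).div_const _
    rw [charFun_apply_real, integral_map hW.aemeasurable
      (Continuous.aestronglyMeasurable (by fun_prop))]
    have hpt : ∀ ω, Complex.exp (t * normalizedSum P X ω * Complex.I)
        = Complex.exp (-((m 1 : ℂ) * z)) * Complex.exp (z * S ω) := by
      intro ω
      rw [← Complex.exp_add]
      congr 1
      simp only [normalizedSum, hz, hm, pow_one]
      push_cast
      ring
    simp_rw [hpt]
    rw [integral_const_mul, hmain, ← Complex.exp_add, ← hsplit]
    simp only [Finset.sum_range_succ, Finset.sum_range_zero, ha0, ha1]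
    congr 1
    ring

end CharFun

/-! ### The Fejér kernel -/

section Fejer

open FourierTransform

variable {T : ℝ}

/-- The triangle function supported on `[-T, T]` with value `1` at the origin. -/
noncomputable def triangle (T ζ : ℝ) : ℝ := max 0 (1 - |ζ| / T)

/-- The Fejér kernel `(1 - cos (T x)) / (π T x ^ 2)`, with the value `0` at the origin. -/
noncomputable def fejerKernel (T x : ℝ) : ℝ := (1 - Real.cos (T * x)) / (Real.pi * T * x ^ 2)

theorem triangle_nonneg (T ζ : ℝ) : 0 ≤ triangle T ζ := le_max_left _ _

theorem triangle_le_one (hT : 0 < T) (ζ : ℝ) : triangle T ζ ≤ 1 :=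
  max_le zero_le_one (sub_le_self _ (by positivity))

theorem triangle_eq_zero (hT : 0 < T) {ζ : ℝ} (h : T ≤ |ζ|) : triangle T ζ = 0 :=
  max_eq_left (by rw [sub_nonpos, le_div_iff₀ hT]; linarith)

theorem triangle_of_le (hT : 0 < T) {ζ : ℝ} (h : |ζ| ≤ T) : triangle T ζ = 1 - |ζ| / T :=
  max_eq_right (by rw [sub_nonneg, div_le_iff₀ hT]; linarith)

theorem continuous_triangle (T : ℝ) : Continuous (triangle T) := by
  unfold triangle; fun_prop

theorem integrable_triangle (hT : 0 < T) : Integrable (triangle T) := by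
  refine (continuous_triangle T).integrable_of_hasCompactSupport
    (HasCompactSupport.intro (isCompact_Icc (a := -T) (b := T)) fun ζ hζ => triangle_eq_zero hT ?_)
  rw [Set.mem_Icc, ← abs_le] at hζ
  exact (not_le.1 hζ).le

theorem integral_triangle_mul_exp_half (hT : 0 < T) {x : ℝ} (hx : x ≠ 0) :
    ∫ ζ in (0 : ℝ)..T, ((1 - ζ / T : ℝ) : ℂ) * Complex.exp (ζ * x * Complex.I)
      = (1 - Complex.exp (T * x * Complex.I)) / (T * x ^ 2) - 1 / (x * Complex.I) := by
  have hxc : (x : ℂ) ≠ 0 := by exact_mod_cast hx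
  have hTc : (T : ℂ) ≠ 0 := by exact_mod_cast hT.ne'
  have hI := Complex.I_ne_zero
  have hderiv : ∀ ζ : ℝ, HasDerivAt (fun ζ : ℝ =>
      ((1 - ζ / T : ℝ) : ℂ) * Complex.exp (ζ * x * Complex.I) / (x * Complex.I)
        + Complex.exp (ζ * x * Complex.I) / (T * (x * Complex.I) ^ 2))
      (((1 - ζ / T : ℝ) : ℂ) * Complex.exp (ζ * x * Complex.I)) ζ := by
    intro ζ
    have h1 : HasDerivAt (fun ζ : ℝ => ((1 - ζ / T : ℝ) : ℂ)) ((-(1 / T) : ℝ) : ℂ) ζ := by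
      have : HasDerivAt (fun ζ : ℝ => 1 - ζ / T) (-(1 / T)) ζ :=
        ((hasDerivAt_id ζ).div_const T).const_sub 1
      exact this.ofReal_comp
    have h2 : HasDerivAt (fun ζ : ℝ => Complex.exp (ζ * x * Complex.I))
        (Complex.exp (ζ * x * Complex.I) * (x * Complex.I)) ζ := by
      have h3 : HasDerivAt (fun ζ : ℝ => (ζ : ℂ) * x * Complex.I) (x * Complex.I) ζ := by
        have := ((hasDerivAt_id ζ).ofReal_comp.mul_const (x : ℂ)).mul_const Complex.I
        simpa using this
      exact h3.cexp
    have h := ((h1.mul h2).div_const (x * Complex.I)).add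
      (h2.div_const (T * (x * Complex.I) ^ 2))
    refine h.congr_deriv ?_
    push_cast
    field_simp
    ring
  rw [intervalIntegral.integral_eq_sub_of_hasDerivAt (fun ζ _ => hderiv ζ)
    (Continuous.intervalIntegrable (by fun_prop) _ _)]
  simp only [mul_pow, Complex.I_sq]
  push_cast
  rw [div_self hTc]
  simp
  field_simp
  ring

/-- The Fejér kernel is the Fourier transform of the triangle function. -/
theorem integral_triangle_mul_exp (hT : 0 < T) {x : ℝ} (hx : x ≠ 0) :
    ∫ ζ, (triangle T ζ : ℂ) * Complex.exp (ζ * x * Complex.I)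
      = 2 * Real.pi * fejerKernel T x := by
  have hxc : (x : ℂ) ≠ 0 := by exact_mod_cast hx
  have hTc : (T : ℂ) ≠ 0 := by exact_mod_cast hT.ne'
  have hpi : (Real.pi : ℂ) ≠ 0 := by exact_mod_cast Real.pi_ne_zero
  set g : ℝ → ℂ := fun ζ => (triangle T ζ : ℂ) * Complex.exp (ζ * x * Complex.I) with hg
  have hgc : Continuous g := by
    have := continuous_triangle T
    fun_prop
  have hsupp : ∫ ζ, g ζ = ∫ ζ in (-T)..T, g ζ := by
    rw [intervalIntegral.integral_of_le (by linarith)]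
    symm
    refine setIntegral_eq_integral_of_forall_compl_eq_zero fun ζ hζ => ?_
    have : triangle T ζ = 0 := by
      refine triangle_eq_zero hT ?_
      by_contra h
      rw [not_le, abs_lt] at h
      exact hζ ⟨h.1, h.2.le⟩
    simp [hg, this]
  have hpos : ∫ ζ in (0 : ℝ)..T, g ζ
      = (1 - Complex.exp (T * x * Complex.I)) / (T * x ^ 2) - 1 / (x * Complex.I) := by
    rw [← integral_triangle_mul_exp_half hT hx]
    refine intervalIntegral.integral_congr fun ζ hζ => ?_
    rw [Set.uIcc_of_le hT.le] at hζ
    simp only [hg]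
    rw [triangle_of_le hT (by rw [abs_of_nonneg hζ.1]; exact hζ.2), abs_of_nonneg hζ.1]
  have hneg : ∫ ζ in (-T)..0, g ζ
      = (1 - Complex.exp (-(T * x * Complex.I))) / (T * x ^ 2) + 1 / (x * Complex.I) := by
    have h := intervalIntegral.integral_comp_neg (a := 0) (b := T) g
    rw [neg_zero] at h
    have h2 := integral_triangle_mul_exp_half hT (neg_ne_zero.2 hx)
    have h3 : ∫ ζ in (0 : ℝ)..T, g (-ζ)
        = ∫ ζ in (0 : ℝ)..T, ((1 - ζ / T : ℝ) : ℂ) * Complex.exp (ζ * (-x : ℝ) * Complex.I) := by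
      refine intervalIntegral.integral_congr fun ζ hζ => ?_
      rw [Set.uIcc_of_le hT.le] at hζ
      simp only [hg]
      rw [triangle_of_le hT (by rw [abs_neg, abs_of_nonneg hζ.1]; exact hζ.2), abs_neg,
        abs_of_nonneg hζ.1]
      push_cast
      ring_nf
    rw [← h, h3, h2]
    push_cast
    rw [neg_sq, neg_mul, div_neg, sub_neg_eq_add, mul_neg, neg_mul]
  rw [hsupp, ← intervalIntegral.integral_add_adjacent_intervals
    (hgc.intervalIntegrable (-T) 0) (hgc.intervalIntegrable 0 T), hpos, hneg, fejerKernel]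
  have hcos : Complex.exp (T * x * Complex.I) + Complex.exp (-(T * x * Complex.I))
      = 2 * Complex.cos (T * x) := by
    rw [Complex.cos]; ring_nf
  push_cast
  field_simp
  linear_combination -Complex.I * hcos

theorem fejerKernel_nonneg (hT : 0 < T) (x : ℝ) : 0 ≤ fejerKernel T x :=
  div_nonneg (sub_nonneg.2 (Real.cos_le_one _)) (by positivity)

theorem fejerKernel_neg (T x : ℝ) : fejerKernel T (-x) = fejerKernel T x := by
  simp [fejerKernel]

theorem measurable_fejerKernel (T : ℝ) : Measurable (fejerKernel T) := by
  unfold fejerKernel; fun_prop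

theorem fejerKernel_mul_sq_le (hT : 0 < T) (x : ℝ) :
    fejerKernel T x * x ^ 2 ≤ 2 / (Real.pi * T) := by
  rcases eq_or_ne x 0 with rfl | hx
  · simp; positivity
  · rw [fejerKernel]
    have : (1 - Real.cos (T * x)) / (Real.pi * T * x ^ 2) * x ^ 2
        = (1 - Real.cos (T * x)) / (Real.pi * T) := by field_simp
    rw [this]
    gcongr
    linarith [Real.neg_one_le_cos (T * x)]

theorem fejerKernel_le (hT : 0 < T) (x : ℝ) : fejerKernel T x ≤ T / (2 * Real.pi) := by
  rcases eq_or_ne x 0 with rfl | hx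
  · simp [fejerKernel]; positivity
  · rw [fejerKernel, div_le_div_iff₀ (by positivity) (by positivity)]
    have h := Real.one_sub_sq_div_two_le_cos (x := T * x)
    nlinarith [Real.pi_pos]

theorem integrable_fejerKernel (hT : 0 < T) : Integrable (fejerKernel T) := by
  refine (integrable_inv_one_add_sq.const_mul
    (T / (2 * Real.pi) + 2 / (Real.pi * T))).mono' (measurable_fejerKernel T).aestronglyMeasurable
    (Filter.Eventually.of_forall fun x => ?_)
  rw [Real.norm_eq_abs, abs_of_nonneg (fejerKernel_nonneg hT x), ← div_eq_mul_inv,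
    le_div_iff₀ (by positivity)]
  linarith [fejerKernel_le hT x, fejerKernel_mul_sq_le hT x]

theorem integral_fejerKernel (hT : 0 < T) : ∫ x, fejerKernel T x = 1 := by
  set f : ℝ → ℂ := fun ζ => (triangle T ζ : ℂ) with hf
  have hfi : Integrable f := (integrable_triangle hT).ofReal
  have hF : ∀ᵐ w : ℝ, 𝓕 f w = ((2 * Real.pi * fejerKernel T (2 * Real.pi * w) : ℝ) : ℂ) := by
    have h0 : ∀ᵐ w : ℝ, w ≠ 0 := by simp [ae_iff, measure_singleton]
    filter_upwards [h0] with w hw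
    have hw' : (-(2 * Real.pi * w)) ≠ 0 := by
      have := Real.pi_ne_zero
      simp [hw, this]
    rw [Real.fourier_real_eq_integral_exp_smul]
    have h := integral_triangle_mul_exp hT hw'
    rw [fejerKernel_neg] at h
    push_cast at h ⊢
    rw [← h]
    refine integral_congr_ae (Filter.Eventually.of_forall fun ζ => ?_)
    simp only [hf, smul_eq_mul]
    rw [mul_comm]
    congr 2
    ring
  have hFi : Integrable (𝓕 f) := by
    have h1 : Integrable fun w : ℝ => fejerKernel T (2 * Real.pi * w) :=
      (integrable_fejerKernel hT).comp_mul_left' (by positivity)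
    exact ((h1.const_mul (2 * Real.pi)).ofReal (𝕜 := ℂ)).congr (hF.mono fun w hw => hw.symm)
  have hinv := hfi.fourierInv_fourier_eq hFi
    (v := 0) (Complex.continuous_ofReal.comp (continuous_triangle T)).continuousAt
  have h1 : f 0 = 1 := by simp [hf, triangle]
  rw [h1, Real.fourierInv_eq] at hinv
  simp only [inner_zero_right, AddChar.map_zero_eq_one, one_smul] at hinv
  rw [integral_congr_ae hF, integral_complex_ofReal, integral_const_mul,
    Measure.integral_comp_mul_left (fejerKernel T), abs_of_pos (by positivity), smul_eq_mul,
    ← mul_assoc, mul_inv_cancel₀ (by positivity), one_mul] at hinv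
  exact_mod_cast hinv

/-- The mass of the Fejér kernel far from the origin. -/
theorem integral_fejerKernel_compl_le (hT : 0 < T) {h : ℝ} (hh : 0 < h) :
    ∫ x in {x : ℝ | h ≤ |x|}, fejerKernel T x ≤ 4 / (Real.pi * T * h) := by
  have hset : {x : ℝ | h ≤ |x|} = Set.Iic (-h) ∪ Set.Ici h := by
    ext x
    simp only [Set.mem_ofPred_eq, Set.mem_union, Set.mem_Iic, Set.mem_Ici, le_abs]
    constructor
    · rintro (h | h)
      · exact Or.inr h
      · exact Or.inl (by linarith)
    · rintro (h | h)
      · exact Or.inr (by linarith)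
      · exact Or.inl h
  have hdisj : Disjoint (Set.Iic (-h)) (Set.Ici h) := by
    rw [Set.disjoint_left]
    intro x h1 h2
    rw [Set.mem_Iic] at h1
    rw [Set.mem_Ici] at h2
    linarith
  have hi := integrable_fejerKernel hT
  rw [hset, setIntegral_union hdisj measurableSet_Ici hi.integrableOn hi.integrableOn]
  have hsymm : ∫ x in Set.Iic (-h), fejerKernel T x = ∫ x in Set.Ioi h, fejerKernel T x := by
    rw [← integral_comp_neg_Ioi]
    simp_rw [fejerKernel_neg]
  have hIoi : ∫ x in Set.Ioi h, fejerKernel T x ≤ 2 / (Real.pi * T) * (1 / h) := by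
    have hr := integral_Ioi_rpow_of_lt (a := -2) (by norm_num) hh
    have hri := integrableOn_Ioi_rpow_of_lt (a := -2) (by norm_num) hh
    have h2 : 1 / h = -h ^ (-2 + 1 : ℝ) / (-2 + 1) := by
      norm_num [Real.rpow_neg_one]
    rw [h2, ← hr, ← integral_const_mul]
    refine setIntegral_mono_on hi.integrableOn (hri.const_mul _) measurableSet_Ioi fun x hx => ?_
    have hx0 : 0 < x := hh.trans hx
    rw [show (-2 : ℝ) = -((2 : ℕ) : ℝ) by norm_num, Real.rpow_neg hx0.le, Real.rpow_natCast,
      ← div_eq_mul_inv, le_div_iff₀ (by positivity)]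
    exact fejerKernel_mul_sq_le hT x
  rw [hsymm, integral_Ici_eq_integral_Ioi]
  calc _ ≤ 2 / (Real.pi * T) * (1 / h) + 2 / (Real.pi * T) * (1 / h) := add_le_add hIoi hIoi
    _ = _ := by field_simp; ring

end Fejer

/-! ### The smoothing inequality -/

section Smoothing

variable {T : ℝ}

/-- The difference of the distribution functions of two measures. -/
noncomputable def cdfDiff (μ ν : Measure ℝ) (y : ℝ) : ℝ :=
  μ.real (Set.Iic y) - ν.real (Set.Iic y)

theorem measurable_measureReal_Iic (μ : Measure ℝ) [IsFiniteMeasure μ] :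
    Measurable fun y => μ.real (Set.Iic y) :=
  Monotone.measurable fun _ _ h => measureReal_mono (Set.Iic_subset_Iic.2 h)

theorem measurable_cdfDiff (μ ν : Measure ℝ) [IsFiniteMeasure μ] [IsFiniteMeasure ν] :
    Measurable (cdfDiff μ ν) :=
  (measurable_measureReal_Iic μ).sub (measurable_measureReal_Iic ν)

theorem abs_cdfDiff_le_one (μ ν : Measure ℝ) [IsProbabilityMeasure μ] [IsProbabilityMeasure ν]
    (y : ℝ) : |cdfDiff μ ν y| ≤ 1 := by
  have h1 : 0 ≤ μ.real (Set.Iic y) := measureReal_nonneg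
  have h2 : 0 ≤ ν.real (Set.Iic y) := measureReal_nonneg
  have h3 : μ.real (Set.Iic y) ≤ 1 := measureReal_le_one
  have h4 : ν.real (Set.Iic y) ≤ 1 := measureReal_le_one
  rw [cdfDiff, abs_le]
  constructor <;> linarith

theorem integrable_mul_fejerKernel (hT : 0 < T) {f : ℝ → ℝ} (hf : Measurable f) {C : ℝ}
    (hC : ∀ x, |f x| ≤ C) : Integrable fun x => f x * fejerKernel T x :=
  (integrable_fejerKernel hT).bdd_mul hf.aestronglyMeasurable (Filter.Eventually.of_forall hC)

/-- A function bounded by `η` that is at least `δ` at `x₀` and decreases with slope at most `m` to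
the right of `x₀` stays large when it is smoothed around the point `x₀ + δ / (2 m)`. -/
theorem le_integral_mul_fejerKernel (hT : 0 < T) {f : ℝ → ℝ} (hf : Measurable f) {η δ m x₀ : ℝ}
    (hη : ∀ x, |f x| ≤ η) (hδ : 0 < δ) (hm : 0 < m)
    (hslope : ∀ s, 0 ≤ s → δ - m * s ≤ f (x₀ + s)) :
    δ / 2 - (δ / 2 + η) * (8 * m / (Real.pi * T * δ))
      ≤ ∫ x, f (x₀ + δ / (2 * m) - x) * fejerKernel T x := by
  set h := δ / (2 * m) with hh
  have hh0 : 0 < h := by positivity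
  have hη0 : 0 ≤ η := (abs_nonneg _).trans (hη 0)
  have hK := integrable_fejerKernel hT
  have hK0 := fejerKernel_nonneg hT
  set A : Set ℝ := {x | h ≤ |x|} with hA
  have hAm : MeasurableSet A := measurableSet_le measurable_const measurable_id.abs
  -- On `|x| < h` the integrand is at least `(δ / 2 + m x)` times the kernel, and the linear term
  -- integrates to zero by symmetry.
  set u : ℝ → ℝ := fun x => if |x| < h then x else 0 with hu
  have hum : Measurable u :=
    Measurable.ite (measurableSet_lt measurable_id.abs measurable_const) measurable_id
      measurable_const
  have hub : ∀ x, |u x| ≤ h := by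
    intro x
    simp only [hu]
    split_ifs with hx
    · exact hx.le
    · simpa using hh0.le
  have hui := integrable_mul_fejerKernel hT hum hub
  have hodd : ∫ x, u x * fejerKernel T x = 0 := by
    have h1 := integral_neg_eq_self (fun x => u x * fejerKernel T x) volume
    have h2 : ∀ x, u (-x) * fejerKernel T (-x) = -(u x * fejerKernel T x) := by
      intro x
      simp only [hu, abs_neg, fejerKernel_neg]
      split_ifs <;> ring
    simp_rw [h2] at h1
    rw [integral_neg] at h1
    linarith
  have hA_le := integral_fejerKernel_compl_le hT hh0
  have hAi : Integrable (A.indicator (fejerKernel T)) := hK.indicator hAm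
  have hi : Integrable fun x => δ / 2 * fejerKernel T x + m * (u x * fejerKernel T x) :=
    (hK.const_mul _).add (hui.const_mul _)
  calc δ / 2 - (δ / 2 + η) * (8 * m / (Real.pi * T * δ))
      = δ / 2 * 1 + m * 0 - (δ / 2 + η) * (4 / (Real.pi * T * h)) := by
        rw [hh]; field_simp; ring
    _ ≤ δ / 2 * (∫ x, fejerKernel T x) + m * (∫ x, u x * fejerKernel T x)
          - (δ / 2 + η) * ∫ x, A.indicator (fejerKernel T) x := by
        rw [integral_fejerKernel hT, hodd, integral_indicator hAm]
        gcongr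
    _ = ∫ x, (δ / 2 * fejerKernel T x + m * (u x * fejerKernel T x)
          - (δ / 2 + η) * A.indicator (fejerKernel T) x) := by
        rw [integral_sub hi (hAi.const_mul _),
          integral_add (hK.const_mul _) (hui.const_mul _), integral_const_mul,
          integral_const_mul, integral_const_mul]
    _ ≤ _ := by
        refine integral_mono (hi.sub (hAi.const_mul _))
          (integrable_mul_fejerKernel hT (hf.comp (measurable_const.sub measurable_id))
            fun x => hη _) fun x => ?_
        by_cases hx : |x| < h
        · have hxA : x ∉ A := by simpa [hA] using hx
          have h1 := hslope (h - x) (by linarith [(abs_lt.1 hx).2])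
          have h2 : m * h = δ / 2 := by rw [hh]; field_simp
          have h3 : x₀ + (h - x) = x₀ + h - x := by ring
          rw [h3] at h1
          simp only [hu, if_pos hx, Set.indicator_of_notMem hxA]
          nlinarith [hK0 x]
        · have hxA : x ∈ A := by simpa [hA] using hx
          have h1 := (abs_le.1 (hη (x₀ + h - x))).1
          simp only [hu, if_neg hx, Set.indicator_of_mem hxA]
          nlinarith [hK0 x]

/-- Smoothing by the Fejér kernel controls the Kolmogorov distance to a distribution with
density bounded by `m`. -/
theorem dKol_le_of_abs_integral_le {μ ν : Measure ℝ} [IsProbabilityMeasure μ]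
    [IsProbabilityMeasure ν] (hT : 0 < T) {m A : ℝ} (hm : 0 < m)
    (hν : ∀ x y, x ≤ y → ν.real (Set.Iic y) - ν.real (Set.Iic x) ≤ m * (y - x))
    (hA : ∀ t, |∫ x, cdfDiff μ ν (t - x) * fejerKernel T x| ≤ A) :
    dKol μ ν ≤ 2 * A + 24 * m / (Real.pi * T) := by
  set η := dKol μ ν with hη
  have hbdd : BddAbove (Set.range fun t => |cdfDiff μ ν t|) :=
    ⟨1, by rintro _ ⟨t, rfl⟩; exact abs_cdfDiff_le_one μ ν t⟩
  have hle : ∀ x, |cdfDiff μ ν x| ≤ η := fun x => le_ciSup hbdd x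
  have hη0 : 0 ≤ η := (abs_nonneg _).trans (hle 0)
  have hA0 : 0 ≤ A := (abs_nonneg _).trans (hA 0)
  have hmeas := measurable_cdfDiff μ ν
  have hF : ∀ x s, 0 ≤ s → μ.real (Set.Iic x) ≤ μ.real (Set.Iic (x + s)) := fun x s hs =>
    measureReal_mono (Set.Iic_subset_Iic.2 (by linarith))
  have hπ := Real.pi_pos
  have key : ∀ x, 0 < |cdfDiff μ ν x| → |cdfDiff μ ν x| / 2
      - (|cdfDiff μ ν x| / 2 + η) * (8 * m / (Real.pi * T * |cdfDiff μ ν x|)) ≤ A := by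
    intro x hx
    rcases le_total 0 (cdfDiff μ ν x) with h0 | h0
    · refine (le_integral_mul_fejerKernel hT hmeas hle hx hm (x₀ := x) fun s hs => ?_).trans
        ((le_abs_self _).trans (hA _))
      rw [abs_of_nonneg h0]
      have h1 := hF x s hs
      have h2 := hν x (x + s) (by linarith)
      simp only [cdfDiff] at *
      linarith
    -- If the difference is negative at `x`, it stays negative to the left of `x`: reflect.
    · refine (le_integral_mul_fejerKernel hT (f := fun y => -cdfDiff μ ν (-y))
        (hmeas.comp measurable_neg).neg (fun y => by rw [abs_neg]; exact hle _) hx hm (x₀ := -x)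
        fun s hs => ?_).trans ?_
      · rw [abs_of_nonpos h0]
        have h1 := hF (x - s) s hs
        have h2 := hν (x - s) x (by linarith)
        rw [sub_add_cancel] at h1
        have h3 : -(-x + s) = x - s := by ring
        simp only [h3, cdfDiff] at *
        linarith
      · set t := -x + |cdfDiff μ ν x| / (2 * m)
        have h1 := integral_neg_eq_self
          (fun y => -cdfDiff μ ν (-(t - y)) * fejerKernel T y) volume
        rw [← h1]
        have h2 : ∀ y, -cdfDiff μ ν (-(t - -y)) * fejerKernel T (-y)
            = -(cdfDiff μ ν (-t - y) * fejerKernel T y) := by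
          intro y
          rw [fejerKernel_neg, show -(t - -y) = -t - y by ring]
          ring
        simp_rw [h2]
        rw [integral_neg]
        exact (neg_le_abs _).trans (hA _)
  -- Multiplying `key` by `δ = |cdfDiff μ ν x| ≤ η` gives `δ ^ 2 ≤ 2 η c`; then the supremum over
  -- `x`, which need not be attained, can be taken.
  set c := A + 12 * m / (Real.pi * T) with hc
  have hc0 : 0 ≤ c := by positivity
  have hsq : ∀ x, |cdfDiff μ ν x| ≤ √(2 * η * c) := by
    intro x
    rcases (abs_nonneg (cdfDiff μ ν x)).eq_or_lt with h0 | h0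
    · rw [← h0]; exact Real.sqrt_nonneg _
    · apply Real.le_sqrt_of_sq_le
      have h1 := key x h0
      set δ := |cdfDiff μ ν x| with hδ
      have hδη : δ ≤ η := hle x
      have h2 : (δ / 2 + η) * (8 * m / (Real.pi * T * δ)) * δ
          = (δ / 2 + η) * (8 * m / (Real.pi * T)) := by field_simp
      have h3 : (δ / 2 + η) * (8 * m / (Real.pi * T)) ≤ (η / 2 + η) * (8 * m / (Real.pi * T)) := by
        gcongr
      have h4 : δ ^ 2 / 2 - (δ / 2 + η) * (8 * m / (Real.pi * T * δ)) * δ ≤ A * δ := by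
        nlinarith
      have h5 : A * δ ≤ A * η := mul_le_mul_of_nonneg_left hδη hA0
      have h6 : (η / 2 + η) * (8 * m / (Real.pi * T)) = η * (12 * m / (Real.pi * T)) := by ring
      rw [hc]
      nlinarith
  have hfin : η ≤ √(2 * η * c) := ciSup_le hsq
  have hfin2 : η ^ 2 ≤ 2 * η * c := by
    have := pow_le_pow_left₀ hη0 hfin 2
    rwa [Real.sq_sqrt (by positivity)] at this
  rcases hη0.eq_or_lt with h0 | h0
  · rw [← h0]; positivity
  · have : η ≤ 2 * c := by nlinarith
    rw [hc] at this
    calc η ≤ 2 * (A + 12 * m / (Real.pi * T)) := this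
      _ = _ := by ring

/-- The integral of `exp (-i ζ y)` for `y` from `0` to `w`. -/
noncomputable def expPrimitive (ζ w : ℝ) : ℂ :=
  if ζ = 0 then (w : ℂ) else (1 - Complex.exp (-(ζ * w * Complex.I))) / (ζ * Complex.I)

theorem integral_exp_eq_expPrimitive (ζ w : ℝ) :
    ∫ y in (0 : ℝ)..w, Complex.exp (-(ζ * y * Complex.I)) = expPrimitive ζ w := by
  unfold expPrimitive
  split_ifs with h
  · simp [h]
  · have hc : -(ζ * Complex.I) ≠ 0 := by
      simp [h, Complex.I_ne_zero]
    have := integral_exp_mul_complex (a := 0) (b := w) hc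
    simp only [Complex.ofReal_zero, mul_zero, Complex.exp_zero] at this
    have h2 : ∀ y : ℝ, -((ζ : ℂ) * y * Complex.I) = -(ζ * Complex.I) * y := fun y => by ring
    simp_rw [h2]
    rw [this, div_neg, ← neg_div, neg_sub]

theorem norm_expPrimitive_le (ζ w : ℝ) : ‖expPrimitive ζ w‖ ≤ |w| := by
  rw [← integral_exp_eq_expPrimitive]
  have := intervalIntegral.norm_integral_le_of_norm_le_const (a := 0) (b := w) (C := 1)
    (f := fun y : ℝ => Complex.exp (-(ζ * y * Complex.I))) fun y _ => by
      rw [show -((ζ : ℂ) * y * Complex.I) = ((-(ζ * y) : ℝ) : ℂ) * Complex.I by push_cast; ring,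
        Complex.norm_exp_ofReal_mul_I]
  simpa using this

theorem measurable_expPrimitive : Measurable fun p : ℝ × ℝ => expPrimitive p.2 p.1 := by
  unfold expPrimitive
  refine Measurable.ite (measurable_snd (measurableSet_singleton 0)) (by fun_prop) (by fun_prop)

/-- The smoothed Heaviside difference in terms of the triangle function. -/
theorem integral_fejerKernel_interval (hT : 0 < T) (t w : ℝ) :
    ((∫ y in (0 : ℝ)..w, fejerKernel T (t - y) : ℝ) : ℂ) = 1 / (2 * Real.pi) *
      ∫ ζ, (triangle T ζ : ℂ) * Complex.exp (ζ * t * Complex.I) * expPrimitive ζ w := by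
  have hπ : (Real.pi : ℂ) ≠ 0 := by exact_mod_cast Real.pi_ne_zero
  have hK : ∀ y : ℝ, y ≠ t → (fejerKernel T (t - y) : ℂ) = 1 / (2 * Real.pi) *
      ∫ ζ, (triangle T ζ : ℂ) * Complex.exp (ζ * t * Complex.I)
        * Complex.exp (-(ζ * y * Complex.I)) := by
    intro y hy
    have h := integral_triangle_mul_exp hT (sub_ne_zero.2 hy.symm)
    have h2 : ∀ ζ : ℝ, (triangle T ζ : ℂ) * Complex.exp (ζ * t * Complex.I)
        * Complex.exp (-(ζ * y * Complex.I))
        = (triangle T ζ : ℂ) * Complex.exp (ζ * (t - y : ℝ) * Complex.I) := by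
      intro ζ
      rw [mul_assoc, ← Complex.exp_add]
      congr 2
      push_cast
      ring
    simp_rw [h2]
    rw [h]
    field_simp
  have hae : ∀ᵐ y : ℝ, y ≠ t := by simp [ae_iff, measure_singleton]
  rw [← intervalIntegral.integral_ofReal, intervalIntegral.integral_congr_ae
    (hae.mono fun y hy _ => hK y hy), intervalIntegral.integral_const_mul,
    intervalIntegral_integral_swap]
  · congr 1
    refine integral_congr_ae (Filter.Eventually.of_forall fun ζ => ?_)
    simp only
    rw [intervalIntegral.integral_const_mul, integral_exp_eq_expPrimitive]
  · have hfin : IsFiniteMeasure (volume.restrict (Set.uIoc 0 w)) :=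
      ⟨by simp [Set.uIoc, Real.volume_Ioc]⟩
    have hc := continuous_triangle T
    have h1 : Integrable (fun p : ℝ × ℝ => triangle T p.2)
        ((volume.restrict (Set.uIoc 0 w)).prod volume) := by
      simpa using (integrable_const (1 : ℝ) (μ := volume.restrict (Set.uIoc 0 w))).mul_prod
        (integrable_triangle hT)
    refine h1.mono' (Continuous.aestronglyMeasurable
      (by simp only [Function.uncurry_def]; fun_prop))
      (Filter.Eventually.of_forall fun p => ?_)
    simp only [Function.uncurry_def]
    rw [norm_mul, norm_mul, Complex.norm_real, Real.norm_eq_abs,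
      abs_of_nonneg (triangle_nonneg T _),
      show -((p.2 : ℂ) * p.1 * Complex.I) = ((-(p.2 * p.1) : ℝ) : ℂ) * Complex.I by
        push_cast; ring,
      show ((p.2 : ℂ) * t * Complex.I) = ((p.2 * t : ℝ) : ℂ) * Complex.I by push_cast; ring,
      Complex.norm_exp_ofReal_mul_I, Complex.norm_exp_ofReal_mul_I, mul_one, mul_one]

/-- The distribution function, compared with the one of the point mass at the origin and smoothed
by the Fejér kernel. -/
theorem integral_cdf_sub_mul_fejerKernel {μ : Measure ℝ} [IsProbabilityMeasure μ]
    (hμ : Integrable (fun w : ℝ => w) μ) (hT : 0 < T) (t : ℝ) :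
    ((∫ y, (μ.real (Set.Iic y) - if 0 ≤ y then 1 else 0) * fejerKernel T (t - y) : ℝ) : ℂ)
      = -(1 / (2 * Real.pi)) * ∫ ζ, (triangle T ζ : ℂ) * Complex.exp (ζ * t * Complex.I)
          * ∫ w, expPrimitive ζ w ∂μ := by
  set k : ℝ → ℝ := fun y => fejerKernel T (t - y) with hk
  have hki : Integrable k := (integrable_fejerKernel hT).comp_sub_left t
  have hkm : Measurable k := (measurable_fejerKernel T).comp (measurable_const.sub measurable_id)
  -- Fubini's theorem is applied to the unit steps at `w` and at `0`, whose difference is supported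
  -- between `0` and `w`, so that a first moment of `μ` suffices.
  set g : ℝ → ℝ → ℝ := fun w y => ((if w ≤ y then 1 else 0) - (if 0 ≤ y then 1 else 0)) * k y
    with hg
  have hcdf : ∀ y, (μ.real (Set.Iic y) - if 0 ≤ y then 1 else 0) * k y = ∫ w, g w y ∂μ := by
    intro y
    simp only [hg]
    rw [integral_mul_const, integral_sub, integral_const]
    · have : (fun w : ℝ => if w ≤ y then (1 : ℝ) else 0) = (Set.Iic y).indicator 1 := by
        ext w; simp [Set.indicator_apply]
      rw [this, integral_indicator_one measurableSet_Iic]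
      simp
    · have : (fun w : ℝ => if w ≤ y then (1 : ℝ) else 0) = (Set.Iic y).indicator 1 := by
        ext w; simp [Set.indicator_apply]
      rw [this]
      exact (integrable_const (1 : ℝ)).indicator measurableSet_Iic
    · exact integrable_const _
  have hsec : ∀ w, ∫ y, g w y = -∫ y in (0 : ℝ)..w, k y := by
    intro w
    have h1 : ∀ a : ℝ, ∫ y, (if a ≤ y then 1 else 0) * k y = ∫ y in Set.Ioi a, k y := by
      intro a
      rw [← integral_Ici_eq_integral_Ioi, ← integral_indicator measurableSet_Ici]
      congr 1
      ext y
      simp [Set.indicator_apply]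
    have h2 : ∀ a : ℝ, Integrable fun y => (if a ≤ y then (1 : ℝ) else 0) * k y := by
      intro a
      have : (fun y => (if a ≤ y then (1 : ℝ) else 0) * k y) = (Set.Ici a).indicator k := by
        ext y; simp [Set.indicator_apply]
      rw [this]
      exact hki.indicator measurableSet_Ici
    simp only [hg, sub_mul]
    rw [integral_sub (h2 w) (h2 0), h1, h1,
      ← intervalIntegral.integral_Ioi_sub_Ioi' hki.integrableOn hki.integrableOn]
    ring
  have hgm : Measurable (Function.uncurry g) := by
    simp only [hg, Function.uncurry_def]
    refine Measurable.mul (Measurable.sub ?_ ?_) (hkm.comp measurable_snd)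
    · exact Measurable.ite (measurableSet_le measurable_fst measurable_snd) measurable_const
        measurable_const
    · exact Measurable.ite (measurableSet_le measurable_const measurable_snd) measurable_const
        measurable_const
  have hgle : ∀ w y, ‖g w y‖ ≤ (Set.uIcc 0 w).indicator (fun _ => T / (2 * Real.pi)) y := by
    intro w y
    have hk0 : 0 ≤ k y := fejerKernel_nonneg hT _
    have hk1 : k y ≤ T / (2 * Real.pi) := fejerKernel_le hT _
    simp only [hg]
    rw [norm_mul, Real.norm_eq_abs, Real.norm_eq_abs, abs_of_nonneg hk0]
    by_cases hy : y ∈ Set.uIcc 0 w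
    · rw [Set.indicator_of_mem hy]
      refine le_trans (mul_le_of_le_one_left hk0 ?_) hk1
      split_ifs <;> norm_num
    · rw [Set.indicator_of_notMem hy]
      rw [Set.mem_uIcc] at hy
      push Not at hy
      have : ((if w ≤ y then (1 : ℝ) else 0) - (if 0 ≤ y then 1 else 0)) = 0 := by
        split_ifs with h1 h2 h2
        · ring
        · exact absurd (hy.2 h1) (by linarith)
        · exact absurd (hy.1 h2) (by linarith)
        · ring
      rw [this]; simp
  have hind : ∀ w, Integrable ((Set.uIcc 0 w).indicator fun _ : ℝ => T / (2 * Real.pi)) :=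
    fun w => (integrable_indicator_iff measurableSet_uIcc).2
      (integrableOn_const (by simp [Set.uIcc, Real.volume_Icc]))
  have hgi : Integrable (Function.uncurry g) (μ.prod volume) := by
    rw [integrable_prod_iff hgm.aestronglyMeasurable]
    refine ⟨Filter.Eventually.of_forall fun w => (hind w).mono'
      (hgm.comp measurable_prodMk_left).aestronglyMeasurable
      (Filter.Eventually.of_forall (hgle w)), ?_⟩
    refine (hμ.abs.const_mul (T / (2 * Real.pi))).mono'
      hgm.aestronglyMeasurable.norm.integral_prod_right' (Filter.Eventually.of_forall fun w => ?_)
    rw [Real.norm_eq_abs, abs_of_nonneg (integral_nonneg fun _ => norm_nonneg _)]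
    calc ∫ y, ‖Function.uncurry g (w, y)‖
        ≤ ∫ y, (Set.uIcc 0 w).indicator (fun _ => T / (2 * Real.pi)) y :=
          integral_mono_of_nonneg (Filter.Eventually.of_forall fun _ => norm_nonneg _) (hind w)
            (Filter.Eventually.of_forall (hgle w))
      _ = T / (2 * Real.pi) * |w| := by
          rw [integral_indicator measurableSet_uIcc, setIntegral_const, Real.volume_real_interval,
            smul_eq_mul, sub_zero, mul_comm]
  have hstep1 : ∫ y, (μ.real (Set.Iic y) - if 0 ≤ y then 1 else 0) * k y
      = ∫ w, (-∫ y in (0 : ℝ)..w, k y) ∂μ := by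
    simp_rw [hcdf]
    rw [← integral_integral_swap hgi]
    simp_rw [hsec]
  rw [hstep1, ← integral_complex_ofReal]
  have hpt : ∀ w : ℝ, ((-∫ y in (0 : ℝ)..w, k y : ℝ) : ℂ) = -(1 / (2 * Real.pi)) *
      ∫ ζ, (triangle T ζ : ℂ) * Complex.exp (ζ * t * Complex.I) * expPrimitive ζ w := by
    intro w
    rw [Complex.ofReal_neg, integral_fejerKernel_interval hT]
    ring
  simp_rw [hpt]
  rw [integral_const_mul, integral_integral_swap]
  · congr 1
    refine integral_congr_ae (Filter.Eventually.of_forall fun ζ => ?_)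
    simp only
    rw [integral_const_mul]
  · have hc := continuous_triangle T
    refine (hμ.abs.mul_prod (integrable_triangle hT)).mono' ?_
      (Filter.Eventually.of_forall fun p => ?_)
    · simp only [Function.uncurry_def]
      refine (Measurable.mul (Continuous.measurable ?_)
        measurable_expPrimitive).aestronglyMeasurable
      fun_prop
    · simp only [Function.uncurry_def]
      rw [norm_mul, norm_mul, Complex.norm_real, Real.norm_eq_abs,
        abs_of_nonneg (triangle_nonneg T _),
        show ((p.2 : ℂ) * t * Complex.I) = ((p.2 * t : ℝ) : ℂ) * Complex.I by push_cast; ring,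
        Complex.norm_exp_ofReal_mul_I, mul_one, mul_comm]
      exact mul_le_mul_of_nonneg_right (norm_expPrimitive_le _ _) (triangle_nonneg T _)

theorem integral_expPrimitive {μ : Measure ℝ} [IsProbabilityMeasure μ] {ζ : ℝ} (hζ : ζ ≠ 0) :
    ∫ w, expPrimitive ζ w ∂μ = (1 - charFun μ (-ζ)) / (ζ * Complex.I) := by
  simp only [expPrimitive, if_neg hζ]
  rw [integral_div, integral_sub (integrable_const _), charFun_apply_real]
  · simp
  · refine (integrable_const (1 : ℝ)).mono' (Continuous.aestronglyMeasurable (by fun_prop))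
      (Filter.Eventually.of_forall fun w => ?_)
    rw [show -((ζ : ℂ) * w * Complex.I) = ((-(ζ * w) : ℝ) : ℂ) * Complex.I by push_cast; ring,
      Complex.norm_exp_ofReal_mul_I]

/-- Esseen's smoothing inequality: closeness of the characteristic functions on `(-T, T)` bounds
the Kolmogorov distance to a distribution with density bounded by `m`. -/
theorem dKol_le_of_norm_charFun_sub_le {μ ν : Measure ℝ} [IsProbabilityMeasure μ]
    [IsProbabilityMeasure ν] (hμ : Integrable (fun w : ℝ => w) μ)
    (hν : Integrable (fun w : ℝ => w) ν) (hT : 0 < T) {m : ℝ} (hm : 0 < m)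
    (hν' : ∀ x y, x ≤ y → ν.real (Set.Iic y) - ν.real (Set.Iic x) ≤ m * (y - x))
    {h : ℝ → ℝ} (hh : Integrable h) (hh0 : ∀ ζ, 0 ≤ h ζ)
    (hle : ∀ ζ, |ζ| < T → ‖charFun μ ζ - charFun ν ζ‖ ≤ |ζ| * h ζ) :
    dKol μ ν ≤ 1 / Real.pi * (∫ ζ, h ζ) + 24 * m / (Real.pi * T) := by
  have hπ := Real.pi_pos
  refine (dKol_le_of_abs_integral_le hT hm hν' (A := 1 / (2 * Real.pi) * ∫ ζ, h ζ)
    fun t => ?_).trans (le_of_eq ?_)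
  swap
  · congr 1
    field_simp
  have hK := integrable_fejerKernel hT
  have hcdf : ∀ (ρ : Measure ℝ) [IsProbabilityMeasure ρ], Integrable fun y =>
      (ρ.real (Set.Iic y) - if 0 ≤ y then (1 : ℝ) else 0) * fejerKernel T (t - y) := by
    intro ρ _
    refine (hK.comp_sub_left t).bdd_mul (c := 1) ((measurable_measureReal_Iic ρ).sub
      (Measurable.ite (measurableSet_le measurable_const measurable_id) measurable_const
        measurable_const)).aestronglyMeasurable (Filter.Eventually.of_forall fun y => ?_)
    have h1 : 0 ≤ ρ.real (Set.Iic y) := measureReal_nonneg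
    have h3 : ρ.real (Set.Iic y) ≤ 1 := measureReal_le_one
    rw [Real.norm_eq_abs, abs_le]
    split_ifs <;> constructor <;> linarith
  have hΔ : ∫ x, cdfDiff μ ν (t - x) * fejerKernel T x
      = (∫ y, (μ.real (Set.Iic y) - if 0 ≤ y then 1 else 0) * fejerKernel T (t - y))
        - ∫ y, (ν.real (Set.Iic y) - if 0 ≤ y then 1 else 0) * fejerKernel T (t - y) := by
    rw [← integral_sub (hcdf μ) (hcdf ν),
      ← integral_sub_left_eq_self (fun x => cdfDiff μ ν (t - x) * fejerKernel T x) volume t]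
    refine integral_congr_ae (Filter.Eventually.of_forall fun y => ?_)
    simp only [cdfDiff, sub_sub_cancel]
    ring
  have hint : ∀ (ρ : Measure ℝ) [IsProbabilityMeasure ρ], Integrable (fun w : ℝ => w) ρ →
      Integrable fun ζ : ℝ => (triangle T ζ : ℂ) * Complex.exp (ζ * t * Complex.I)
          * ∫ w, expPrimitive ζ w ∂ρ := by
    intro ρ _ hρ
    refine (((integrable_triangle hT).mul_const (∫ w, |w| ∂ρ))).mono' ?_
      (Filter.Eventually.of_forall fun ζ => ?_)
    · have hc := continuous_triangle T
      refine AEStronglyMeasurable.mul (Continuous.aestronglyMeasurable (by fun_prop)) ?_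
      exact (measurable_expPrimitive.comp measurable_swap).stronglyMeasurable.integral_prod_right'
        (ν := ρ) |>.aestronglyMeasurable
    · rw [norm_mul, norm_mul, Complex.norm_real, Real.norm_eq_abs,
        abs_of_nonneg (triangle_nonneg T _),
        show ((ζ : ℂ) * t * Complex.I) = ((ζ * t : ℝ) : ℂ) * Complex.I by push_cast; ring,
        Complex.norm_exp_ofReal_mul_I, mul_one]
      exact mul_le_mul_of_nonneg_left (norm_integral_le_of_norm_le hρ.abs
        (Filter.Eventually.of_forall fun w => norm_expPrimitive_le _ _)) (triangle_nonneg T _)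
  have hC : ((∫ x, cdfDiff μ ν (t - x) * fejerKernel T x : ℝ) : ℂ) = -(1 / (2 * Real.pi)) *
      ∫ ζ, (triangle T ζ : ℂ) * Complex.exp (ζ * t * Complex.I)
          * (∫ w, expPrimitive ζ w ∂μ - ∫ w, expPrimitive ζ w ∂ν) := by
    rw [hΔ, Complex.ofReal_sub, integral_cdf_sub_mul_fejerKernel hμ hT,
      integral_cdf_sub_mul_fejerKernel hν hT, ← mul_sub, ← integral_sub (hint μ hμ) (hint ν hν)]
    simp_rw [← mul_sub]
  rw [← Real.norm_eq_abs, ← Complex.norm_real, hC, norm_mul]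
  have hn : ‖(-(1 / (2 * Real.pi)) : ℂ)‖ = 1 / (2 * Real.pi) := by
    rw [norm_neg, show (1 / (2 * Real.pi) : ℂ) = ((1 / (2 * Real.pi) : ℝ) : ℂ) by push_cast; rfl,
      Complex.norm_real, Real.norm_eq_abs, abs_of_pos (by positivity)]
  rw [hn, ← integral_neg_eq_self h]
  refine mul_le_mul_of_nonneg_left (norm_integral_le_of_norm_le hh.comp_neg ?_) (by positivity)
  have hae : ∀ᵐ ζ : ℝ, ζ ≠ 0 := by simp [ae_iff, measure_singleton]
  filter_upwards [hae] with ζ hζ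
  rw [norm_mul, norm_mul, Complex.norm_real, Real.norm_eq_abs,
    abs_of_nonneg (triangle_nonneg T _),
    show ((ζ : ℂ) * t * Complex.I) = ((ζ * t : ℝ) : ℂ) * Complex.I by push_cast; ring,
    Complex.norm_exp_ofReal_mul_I, mul_one]
  by_cases hζT : |ζ| < T
  · refine (mul_le_of_le_one_left (norm_nonneg _) (triangle_le_one hT ζ)).trans ?_
    rw [integral_expPrimitive hζ, integral_expPrimitive hζ, ← sub_div, norm_div, norm_mul,
      Complex.norm_I, mul_one, Complex.norm_real, Real.norm_eq_abs,
      div_le_iff₀ (abs_pos.2 hζ), sub_sub_sub_cancel_left, norm_sub_rev, mul_comm]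
    have := hle (-ζ) (by rwa [abs_neg])
    rwa [abs_neg] at this
  · rw [triangle_eq_zero hT (not_lt.1 hζT), zero_mul]
    exact hh0 _

end Smoothing

/-! ### Comparison with the standard normal distribution -/

section Gaussian

theorem measureReal_gaussianReal_Iic_sub_le (x y : ℝ) (hxy : x ≤ y) :
    (gaussianReal 0 1).real (Set.Iic y) - (gaussianReal 0 1).real (Set.Iic x)
      ≤ 1 / √(2 * Real.pi) * (y - x) := by
  have hd : (gaussianReal 0 1).real (Set.Iic y) - (gaussianReal 0 1).real (Set.Iic x)
      = (gaussianReal 0 1).real (Set.Ioc x y) := by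
    rw [← measureReal_sdiff (Set.Iic_subset_Iic.2 hxy) measurableSet_Iic]
    congr 1
    ext z
    simp [and_comm]
  have hpdf : ∀ z, gaussianPDFReal 0 1 z ≤ 1 / √(2 * Real.pi) := by
    intro z
    rw [gaussianPDFReal, NNReal.coe_one, mul_one, one_div]
    exact mul_le_of_le_one_right (by positivity)
      (Real.exp_le_one_iff.2 (div_nonpos_of_nonpos_of_nonneg (by nlinarith [sq_nonneg (z - 0)])
        (by norm_num)))
  rw [hd, measureReal_def, gaussianReal_apply_eq_integral 0 one_ne_zero,
    ENNReal.toReal_ofReal (integral_nonneg fun z => gaussianPDFReal_nonneg 0 1 z)]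
  calc ∫ z in Set.Ioc x y, gaussianPDFReal 0 1 z
      ≤ ∫ _ in Set.Ioc x y, 1 / √(2 * Real.pi) :=
        setIntegral_mono (integrable_gaussianPDFReal 0 1).integrableOn
          (integrableOn_const (by simp)) hpdf
    _ = _ := by
        rw [setIntegral_const, Real.volume_real_Ioc_of_le hxy, smul_eq_mul, mul_comm]

theorem integral_abs_mul_exp_neg_mul_sq {b : ℝ} (hb : 0 < b) :
    ∫ x : ℝ, |x| * Real.exp (-b * x ^ 2) = 1 / b := by
  have h := integral_comp_abs (f := fun x : ℝ => x * Real.exp (-b * x ^ 2))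
  simp only [sq_abs] at h
  have h2 := integral_mul_cexp_neg_mul_sq (b := (b : ℂ)) (by simpa using hb)
  have h3 : ((∫ x : ℝ in Set.Ioi 0, x * Real.exp (-b * x ^ 2) : ℝ) : ℂ) = (2 * (b : ℂ))⁻¹ := by
    rw [← h2, ← integral_complex_ofReal]
    push_cast
    rfl
  have h4 : ∫ x : ℝ in Set.Ioi 0, x * Real.exp (-b * x ^ 2) = (2 * b)⁻¹ := by
    exact_mod_cast h3
  rw [h, h4]
  field_simp

theorem integrable_abs_mul_exp_neg_mul_sq {b : ℝ} (hb : 0 < b) :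
    Integrable fun x : ℝ => |x| * Real.exp (-b * x ^ 2) := by
  refine (integrable_mul_exp_neg_mul_sq hb).abs.congr (Filter.Eventually.of_forall fun x => ?_)
  simp only [abs_mul, Real.abs_exp]

/-- By convexity the exponential lies below its chord on `[0, z]`. -/
theorem norm_exp_sub_one_le_mul {E : ℂ} {q z : ℝ} (hq : 0 ≤ q) (hq1 : q ≤ 1)
    (hE : ‖E‖ ≤ q * z) : ‖Complex.exp E - 1‖ ≤ q * (Real.exp z - 1) := by
  have h1 := Complex.norm_exp_sub_sum_le_exp_norm_sub_sum E 1
  simp only [Finset.range_one, Finset.sum_singleton, pow_zero, Nat.factorial_zero,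
    Nat.cast_one, div_one] at h1
  have h2 := convexOn_exp.2 (Set.mem_univ z) (Set.mem_univ 0) hq (sub_nonneg.2 hq1) (by ring)
  simp only [smul_eq_mul, mul_zero, add_zero, Real.exp_zero, mul_one] at h2
  have h3 := Real.exp_le_exp.2 hE
  linarith

/-- A characteristic function that agrees with `exp (-t² / 2)` up to a factor whose logarithm is
of order `|t|³` on the interval `(-T, T)` belongs to an approximately normal distribution. -/
theorem dKol_gaussianReal_le {μ : Measure ℝ} [IsProbabilityMeasure μ]
    (hμ : Integrable (fun w : ℝ => w) μ) {r s T β : ℝ} (hr : 0 ≤ r) (hs : 0 ≤ s) (hT : 0 < T)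
    (hβ : 0 < β) (hβ' : β < 1 / 2) (hrs : r * T + s * T ^ 2 ≤ β)
    (hE : ∀ t, |t| < T → ∃ E : ℂ, ‖E‖ ≤ r * |t| ^ 3 + s * t ^ 4 ∧
      charFun μ t = Complex.exp (-(t ^ 2 / 2 : ℝ) + E)) :
    dKol μ (gaussianReal 0 1) ≤
      (r * (√(Real.pi / (1 / 2 - β)) - √(2 * Real.pi)) + s * (1 / (1 / 2 - β) - 2))
        / (Real.pi * β) + 24 / (√(2 * Real.pi) * Real.pi * T) := by
  have hπ := Real.pi_pos
  set b := 1 / 2 - β with hb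
  have hb0 : 0 < b := by rw [hb]; linarith
  have hi1 : ∀ {c : ℝ}, 0 < c → Integrable fun t : ℝ => Real.exp (-c * t ^ 2) :=
    fun hc => integrable_exp_neg_mul_sq hc
  have hi2 : ∀ {c : ℝ}, 0 < c → Integrable fun t : ℝ => |t| * Real.exp (-c * t ^ 2) :=
    fun hc => integrable_abs_mul_exp_neg_mul_sq hc
  have h2 : (0 : ℝ) < 1 / 2 := by norm_num
  set h : ℝ → ℝ := fun t =>
    r / β * (Real.exp (-b * t ^ 2) - Real.exp (-(1 / 2) * t ^ 2))
      + s / β * (|t| * Real.exp (-b * t ^ 2) - |t| * Real.exp (-(1 / 2) * t ^ 2)) with hh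
  have hhi1 : Integrable fun t : ℝ =>
      r / β * (Real.exp (-b * t ^ 2) - Real.exp (-(1 / 2) * t ^ 2)) :=
    ((hi1 hb0).sub (hi1 h2)).const_mul _
  have hhi2 : Integrable fun t : ℝ =>
      s / β * (|t| * Real.exp (-b * t ^ 2) - |t| * Real.exp (-(1 / 2) * t ^ 2)) :=
    ((hi2 hb0).sub (hi2 h2)).const_mul _
  have hexp : ∀ t : ℝ, Real.exp (-(1 / 2) * t ^ 2) ≤ Real.exp (-b * t ^ 2) := by
    intro t
    apply Real.exp_le_exp.2
    rw [hb]
    nlinarith [sq_nonneg t]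
  have hh0 : ∀ t, 0 ≤ h t := by
    intro t
    have h3 := sub_nonneg.2 (hexp t)
    have h4 : |t| * Real.exp (-b * t ^ 2) - |t| * Real.exp (-(1 / 2) * t ^ 2)
        = |t| * (Real.exp (-b * t ^ 2) - Real.exp (-(1 / 2) * t ^ 2)) := by ring
    simp only [hh, h4]
    positivity
  have hN : Integrable (fun w : ℝ => w) (gaussianReal 0 1) :=
    (memLp_id_gaussianReal 1).integrable le_rfl
  have hle : ∀ t, |t| < T → ‖charFun μ t - charFun (gaussianReal 0 1) t‖ ≤ |t| * h t := by
    intro t ht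
    obtain ⟨E, hE1, hE2⟩ := hE t ht
    have hq : (r * |t| + s * |t| ^ 2) / β ≤ 1 := by
      rw [div_le_one hβ]
      refine le_trans ?_ hrs
      gcongr
    have hEz : ‖E‖ ≤ (r * |t| + s * |t| ^ 2) / β * (β * t ^ 2) := by
      refine hE1.trans (le_of_eq ?_)
      have h4 : t ^ 4 = |t| ^ 4 := by rw [← abs_pow, abs_of_nonneg (by positivity)]
      rw [h4, ← sq_abs t]
      field_simp
    have h3 := norm_exp_sub_one_le_mul (by positivity) hq hEz
    have hg : charFun (gaussianReal 0 1) t = Complex.exp (-(t ^ 2 / 2 : ℝ)) := by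
      rw [charFun_gaussianReal]
      congr 1
      push_cast
      simp
    have h5 : ‖Complex.exp (-(t ^ 2 / 2 : ℝ))‖ = Real.exp (-(1 / 2) * t ^ 2) := by
      rw [← Complex.ofReal_neg, Complex.norm_exp_ofReal]
      congr 1
      ring
    rw [hg, hE2, Complex.exp_add,
      show ∀ a c : ℂ, a * c - a = a * (c - 1) from fun a c => by ring, norm_mul, h5]
    have h6 : Real.exp (-b * t ^ 2) = Real.exp (-(1 / 2) * t ^ 2) * Real.exp (β * t ^ 2) := by
      rw [← Real.exp_add]
      congr 1
      rw [hb]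
      ring
    calc Real.exp (-(1 / 2) * t ^ 2) * ‖Complex.exp E - 1‖
        ≤ Real.exp (-(1 / 2) * t ^ 2)
            * ((r * |t| + s * |t| ^ 2) / β * (Real.exp (β * t ^ 2) - 1)) := by gcongr
      _ = |t| * h t := by
          simp only [hh]
          rw [h6]
          ring
  have hmain := dKol_le_of_norm_charFun_sub_le hμ hN hT (m := 1 / √(2 * Real.pi)) (by positivity)
    measureReal_gaussianReal_Iic_sub_le (h := h) (hhi1.add hhi2) hh0 hle
  refine hmain.trans (le_of_eq ?_)
  have hint : ∫ t, h t = r / β * (√(Real.pi / b) - √(2 * Real.pi)) + s / β * (1 / b - 2) := by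
    simp only [hh]
    rw [integral_add hhi1 hhi2, integral_const_mul, integral_const_mul,
      integral_sub (hi1 hb0) (hi1 h2), integral_sub (hi2 hb0) (hi2 h2), integral_gaussian,
      integral_gaussian, integral_abs_mul_exp_neg_mul_sq hb0, integral_abs_mul_exp_neg_mul_sq h2,
      show Real.pi / (1 / 2) = 2 * Real.pi by ring]
    norm_num
  rw [hint]
  field_simp

/-- The bound of `dKol_gaussianReal_le` with `β = 0.36` and the largest admissible `T`. -/
theorem dKol_gaussianReal_le_of_charFun {μ : Measure ℝ} [IsProbabilityMeasure μ]
    (hμ : Integrable (fun w : ℝ => w) μ) {p a x : ℝ} (hp : 0 ≤ p) (ha : 0 ≤ a) (hx : 0 < x)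
    (hE : ∀ t, |t| * (2 * Real.exp 1 * x) < 1 → ∃ E : ℂ, ‖E‖ ≤ p * |t| ^ 3 / 6 + 19.5 * a * t ^ 4 ∧
      charFun μ t = Complex.exp (-(t ^ 2 / 2 : ℝ) + E)) :
    dKol μ (gaussianReal 0 1) ≤
      0.607148 * p + 116.84 * a + max (16.57 * x) (22.47 * √a + 1.596 * p) := by
  have hπ := Real.pi_pos
  have he := Real.exp_pos 1
  -- With `T = 1 / M` and `M` at least `u + w`, the exponent is at most `0.36 t ^ 2` on `(-T, T)`.
  set u := √(19.5 * a / 0.36) with hu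
  set w := p / 6 / 0.36 with hw
  have hu0 : 0 ≤ u := Real.sqrt_nonneg _
  have hu2 : u ^ 2 = 19.5 * a / 0.36 := Real.sq_sqrt (by positivity)
  have hw0 : 0 ≤ w := by positivity
  set M := max (2 * Real.exp 1 * x) (u + w) with hM
  have hM0 : 0 < M := lt_max_of_lt_left (by positivity)
  have hM1 : 2 * Real.exp 1 * x ≤ M := le_max_left _ _
  have hM2 : u + w ≤ M := le_max_right _ _
  have hrs : p / 6 * (1 / M) + 19.5 * a * (1 / M) ^ 2 ≤ 0.36 := by
    have h1 : p / 6 = 0.36 * w := by rw [hw]; ring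
    have h2 : 19.5 * a = 0.36 * u ^ 2 := by rw [hu2]; ring
    have h3 : w * M + u ^ 2 ≤ M ^ 2 := by nlinarith
    rw [h1, h2]
    have h4 : 0.36 * w * (1 / M) + 0.36 * u ^ 2 * (1 / M) ^ 2
        = 0.36 * ((w * M + u ^ 2) / M ^ 2) := by field_simp
    rw [h4]
    have h5 : (w * M + u ^ 2) / M ^ 2 ≤ 1 := (div_le_one (by positivity)).2 h3
    linarith
  have hmain := dKol_gaussianReal_le hμ (r := p / 6) (s := 19.5 * a) (T := 1 / M) (β := 0.36)
    (by positivity) (by positivity) (by positivity) (by norm_num) (by norm_num) hrs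
    fun t ht => by
      obtain ⟨E, hE1, hE2⟩ := hE t (by
        rw [lt_div_iff₀ hM0] at ht
        exact (mul_le_mul_of_nonneg_left hM1 (abs_nonneg t)).trans_lt ht)
      exact ⟨E, hE1.trans (le_of_eq (by ring)), hE2⟩
  refine hmain.trans ?_
  have hπ1 := Real.pi_gt_d6
  have hπ2 := Real.pi_lt_d6
  have hs1 : 2.50662 ≤ √(2 * Real.pi) := Real.le_sqrt_of_sq_le (by norm_num; linarith)
  have hs2 : √(Real.pi / (1 / 2 - 0.36)) ≤ 4.74 :=
    Real.sqrt_le_iff.2 ⟨by norm_num, by norm_num; linarith⟩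
  have h1 : (p / 6 * (√(Real.pi / (1 / 2 - 0.36)) - √(2 * Real.pi))
      + 19.5 * a * (1 / (1 / 2 - 0.36) - 2)) / (Real.pi * 0.36) ≤ 0.607148 * p + 116.84 * a := by
    rw [div_le_iff₀ (by positivity)]
    have h2 : p / 6 * (√(Real.pi / (1 / 2 - 0.36)) - √(2 * Real.pi)) ≤ p / 6 * (4.74 - 2.50662) :=
      mul_le_mul_of_nonneg_left (by linarith) (by positivity)
    have h3 : p * 3.141592 ≤ p * Real.pi := mul_le_mul_of_nonneg_left hπ1.le hp
    have h4 : a * 3.141592 ≤ a * Real.pi := mul_le_mul_of_nonneg_left hπ1.le ha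
    norm_num at h2 h3 h4 ⊢
    linarith
  have h2 : 24 / (√(2 * Real.pi) * Real.pi * (1 / M)) ≤ 3.0478 * M := by
    have h3 : 2.50662 * 3.141592 ≤ √(2 * Real.pi) * Real.pi := by gcongr
    rw [mul_one_div, div_div_eq_mul_div, div_le_iff₀ (by positivity)]
    nlinarith [mul_le_mul_of_nonneg_left h3 hM0.le]
  have h3 : 3.0478 * M ≤ max (16.57 * x) (22.47 * √a + 1.596 * p) := by
    rw [hM, mul_max_of_nonneg _ _ (by norm_num)]
    refine max_le_max ?_ ?_
    · have := Real.exp_one_lt_d9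
      nlinarith
    · have h4 : u ≤ 7.36 * √a := by
        rw [hu]
        refine Real.sqrt_le_iff.2 ⟨by positivity, ?_⟩
        rw [mul_pow, Real.sq_sqrt ha, div_le_iff₀ (by norm_num)]
        norm_num
        linarith
      have h5 := Real.sqrt_nonneg a
      have h6 : w ≤ 0.463 * p := by
        rw [hw, div_div, div_le_iff₀ (by norm_num)]
        norm_num
        linarith
      linarith
  linarith

end Gaussian

/-! ### Sums with a dependency graph -/

theorem isDependencyGraph_sub_const {V Ω : Type*} [MeasurableSpace Ω] {P : Measure Ω}
    {Y : V → Ω → ℝ} {G : Multigraph V} (hG : IsDependencyGraph P Y G) (c : V → ℝ) :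
    IsDependencyGraph P (fun k ω => Y k ω - c k) G := fun A B hAB hE =>
  (hG A B hAB hE).comp (φ := fun (y : A → ℝ) (k : A) => y k - c k)
    (ψ := fun (y : B → ℝ) (k : B) => y k - c k) (by fun_prop) (by fun_prop)

theorem sumRV_sub_const {V Ω : Type*} [Fintype V] (Y : V → Ω → ℝ) (c : V → ℝ) :
    sumRV (fun k ω => Y k ω - c k) = fun ω => sumRV Y ω - ∑ k, c k := by
  ext ω
  simp [sumRV]

theorem absMomentSum_natCast {V Ω : Type*} [Fintype V] [MeasurableSpace Ω] {P : Measure Ω}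
    (Y : V → Ω → ℝ) (c : V → ℝ) (r : ℕ) :
    absMomentSum P Y c r = absMoment P (fun k ω => Y k ω - c k) r := by
  simp [absMomentSum, absMoment]

/-- The comparison of the two bounds in terms of the normalized quantities `p = ρ / v³`,
`a₃ = (D + 1)² A₃ / v³`, `a₄ = (D + 1)³ A₄ / v⁴` and `x = L (D + 1) / v`. If `B` is the maximum of
`68.5 a₃` and `22.88 x`, then `a₄ ≤ a₃ x ≤ B² / (68.5 · 22.88)`; the constants `0.07456` and
`39.588` are `116.84 / (68.5 · 22.88)` rounded up and `√(68.5 · 22.88)` rounded down. -/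
theorem refined_lt_simple {p a₃ a₄ x κ C : ℝ} (ha₃ : 0 ≤ a₃) (hx : 0 < x) (ha₄ : a₄ ≤ a₃ * x)
    (hp : p ≤ κ * a₃) (hκ : 0 ≤ κ) (hC1 : 16.57 / 22.88 < C - (0.607148 * κ / 68.5 + 0.07456))
    (hC2 : 22.47 / 39.588 + 1.596 * κ / 68.5 < C - (0.607148 * κ / 68.5 + 0.07456))
    (hB : max (68.5 * a₃) (22.88 * x) < 1) :
    0.607148 * p + 116.84 * a₄ + max (16.57 * x) (22.47 * √a₄ + 1.596 * p)
      < C * max (68.5 * a₃) (22.88 * x) := by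
  set B := max (68.5 * a₃) (22.88 * x) with hBdef
  have h1 : 68.5 * a₃ ≤ B := le_max_left _ _
  have h2 : 22.88 * x ≤ B := le_max_right _ _
  have hB0 : 0 < B := by linarith
  have ha3 : a₃ ≤ B / 68.5 := by rw [le_div_iff₀ (by norm_num)]; linarith
  have hp' : p ≤ κ * (B / 68.5) := hp.trans (mul_le_mul_of_nonneg_left ha3 hκ)
  have hax : a₄ ≤ B / 68.5 * (B / 22.88) := ha₄.trans (mul_le_mul ha3
    (by rw [le_div_iff₀ (by norm_num)]; linarith) hx.le (by positivity))
  have hBB : B * B ≤ B := by nlinarith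
  have h4 : 116.84 * a₄ ≤ 0.07456 * B := by
    have : B / 68.5 * (B / 22.88) = B * B / (68.5 * 22.88) := by ring
    rw [this, le_div_iff₀ (by norm_num)] at hax
    norm_num at hax ⊢
    linarith
  have h5 : √a₄ ≤ B / 39.588 := by
    refine Real.sqrt_le_iff.2 ⟨by positivity, hax.trans ?_⟩
    rw [div_mul_div_comm, div_pow, div_le_div_iff₀ (by norm_num) (by norm_num), ← sq]
    exact mul_le_mul_of_nonneg_left (by norm_num) (sq_nonneg B)
  have h6 : max (16.57 * x) (22.47 * √a₄ + 1.596 * p)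
      < (C - (0.607148 * κ / 68.5 + 0.07456)) * B := by
    refine max_lt ?_ ?_
    · calc 16.57 * x ≤ 16.57 / 22.88 * B := by
            rw [div_mul_eq_mul_div, le_div_iff₀ (by norm_num)]; linarith
        _ < _ := by gcongr
    · calc 22.47 * √a₄ + 1.596 * p ≤ 22.47 * (B / 39.588) + 1.596 * (κ * (B / 68.5)) := by gcongr
        _ = (22.47 / 39.588 + 1.596 * κ / 68.5) * B := by ring
        _ < _ := by gcongr
  have h7 : 0.607148 * p ≤ 0.607148 * κ / 68.5 * B := by
    calc 0.607148 * p ≤ 0.607148 * (κ * (B / 68.5)) := by gcongr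
      _ = _ := by ring
  linarith

section Assembly

variable {V Ω : Type*} [Fintype V] [MeasurableSpace Ω] {P : Measure Ω} [IsProbabilityMeasure P]
  {X : V → Ω → ℝ} {G : Multigraph V} {L : ℝ}

theorem dKol_normalizedSum_le (hX : ∀ v, Measurable (X v)) (hb : ∀ v, ∀ᵐ ω ∂P, |X v ω| ≤ L)
    (hL : 0 < L) (hG : IsDependencyGraph P X G) {D : ℕ} (hD : maxDegree G ≤ D) [Nonempty V]
    (hv : 0 < stdDev P X) :
    dKol (P.map (normalizedSum P X)) (gaussianReal 0 1) ≤
      0.607148 * (rho P X / stdDev P X ^ 3)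
        + 116.84 * (((D : ℝ) + 1) ^ 3 * absMoment P X 4 / stdDev P X ^ 4)
        + max (16.57 * (L * ((D : ℝ) + 1) / stdDev P X))
            (22.47 * √(((D : ℝ) + 1) ^ 3 * absMoment P X 4 / stdDev P X ^ 4)
              + 1.596 * (rho P X / stdDev P X ^ 3)) := by
  have hS := measurable_sumRV hX
  have hW : Measurable (normalizedSum P X) := (hS.sub_const _).div_const _
  have := Measure.isProbabilityMeasure_map (μ := P) hW.aemeasurable
  have hSi : Integrable (sumRV X) P :=
    Integrable.of_bound hS.aestronglyMeasurable _ (ae_abs_sumRV_le hb)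
  have hWi : Integrable (fun w : ℝ => w) (P.map (normalizedSum P X)) :=
    (integrable_map_measure aestronglyMeasurable_id hW.aemeasurable).2
      ((hSi.sub (integrable_const _)).div_const _)
  have hm := absMoment_nonneg (P := P) X 4
  refine dKol_gaussianReal_le_of_charFun hWi (div_nonneg (abs_nonneg _) (by positivity))
    (by positivity) (by positivity) fun t ht => ?_
  exact exists_charFun_eq_exp hX hb hL hG hD hv (lt_of_eq_of_lt (by field_simp) ht)

theorem rho_le_twelve_mul (hX : ∀ v, Measurable (X v)) (hb : ∀ v, ∀ᵐ ω ∂P, |X v ω| ≤ L)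
    (hG : IsDependencyGraph P X G) {D : ℕ} (hD : maxDegree G ≤ D) [Nonempty V] :
    rho P X ≤ 12 * ((D : ℝ) + 1) ^ 2 * absMoment P X 3 := by
  have h := abs_cumulantSucc_le hX hb hG hD 2
  rw [cumulantSucc_two_eq_integral (measurable_sumRV hX) (ae_abs_sumRV_le hb)] at h
  norm_num at h
  exact h

theorem rho_le_three_mul_of_centred (hX : ∀ v, Measurable (X v))
    (hb : ∀ v, ∀ᵐ ω ∂P, |X v ω| ≤ L) (hG : IsDependencyGraph P X G) {D : ℕ}
    (hD : maxDegree G ≤ D) [Nonempty V] (h0 : ∀ v, ∫ ω, X v ω ∂P = 0) :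
    rho P X ≤ 3 * ((D : ℝ) + 1) ^ 2 * absMoment P X 3 := by
  have h := abs_cumulantSucc_two_le_of_centred hX hb hG hD h0
  rwa [cumulantSucc_two_eq_integral (measurable_sumRV hX) (ae_abs_sumRV_le hb)] at h

theorem stdDev_sub_const {Y : V → Ω → ℝ} (hY : ∀ k, Measurable (Y k)) (c : V → ℝ) :
    stdDev P (fun k ω => Y k ω - c k) = stdDev P Y := by
  rw [stdDev, stdDev, sumRV_sub_const,
    variance_sub_const (measurable_sumRV hY).aestronglyMeasurable]

theorem sumRV_sub_integral_sub_const {Y : V → Ω → ℝ} (hY : Integrable (sumRV Y) P) (c : V → ℝ)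
    (ω : Ω) :
    sumRV (fun k ω => Y k ω - c k) ω - ∫ ω', sumRV (fun k ω => Y k ω - c k) ω' ∂P
      = sumRV Y ω - ∫ ω', sumRV Y ω' ∂P := by
  rw [sumRV_sub_const, integral_sub hY (integrable_const _), integral_const]
  simp

end Assembly

end DepGraph

theorem mainTheorem4 {V Ω : Type*} [Fintype V] [MeasurableSpace Ω]
    (P : Measure Ω) [IsProbabilityMeasure P]
    (Y : V → Ω → ℝ) (hY : ∀ k, Measurable (Y k))
    (G : DepGraph.Multigraph V) (hG : DepGraph.IsDependencyGraph P Y G)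
    (D : ℕ) (hD : DepGraph.maxDegree G = D)
    (c : V → ℝ) (L : ℝ) (hL : 0 < L)
    (hYL : ∀ k, eLpNorm (fun ω => Y k ω - c k) ⊤ P ≤ ENNReal.ofReal L)
    (hv : 0 < DepGraph.stdDev P Y) :
    DepGraph.dKol (P.map (DepGraph.normalizedSum P Y)) (gaussianReal 0 1)
        ≤ DepGraph.refinedBound P Y c L D ∧
      (DepGraph.simpleBound P Y c L D < 1 →
        DepGraph.refinedBound P Y c L D < 1.06164 * DepGraph.simpleBound P Y c L D ∧
        ((∀ k, c k = ∫ ω, Y k ω ∂P) →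
          DepGraph.refinedBound P Y c L D < 0.85771 * DepGraph.simpleBound P Y c L D)) := by
  have hV : Nonempty V := by
    by_contra h
    rw [not_nonempty_iff] at h
    have h0 : DepGraph.sumRV Y = fun _ => 0 := by ext ω; simp [DepGraph.sumRV]
    have h1 : variance (fun _ : Ω => (0 : ℝ)) P = 0 := variance_zero P
    simp [DepGraph.stdDev, h0, h1] at hv
  set X : V → Ω → ℝ := fun k ω => Y k ω - c k with hXdef
  have hX : ∀ k, Measurable (X k) := fun k => (hY k).sub_const _
  have hb : ∀ k, ∀ᵐ ω ∂P, |X k ω| ≤ L := by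
    intro k
    have h := hYL k
    rw [eLpNorm_exponent_top] at h
    filter_upwards [ae_le_eLpNormEssSup (f := X k) (μ := P)] with ω hω
    have h1 := hω.trans h
    rwa [← ofReal_norm, ENNReal.ofReal_le_ofReal_iff hL.le, Real.norm_eq_abs] at h1
  have hGX : DepGraph.IsDependencyGraph P X G := DepGraph.isDependencyGraph_sub_const hG c
  have hYi : ∀ k, Integrable (Y k) P := fun k => by
    have h := (Integrable.of_bound (hX k).aestronglyMeasurable L (hb k)).add
      (integrable_const (c k))
    simpa [X, Pi.add_def] using h
  have hSi : Integrable (DepGraph.sumRV Y) P := integrable_finsetSum _ fun k _ => hYi k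
  have hsd : DepGraph.stdDev P X = DepGraph.stdDev P Y := DepGraph.stdDev_sub_const hY c
  have hdiff := DepGraph.sumRV_sub_integral_sub_const hSi c
  have hW : DepGraph.normalizedSum P X = DepGraph.normalizedSum P Y := by
    ext ω
    rw [DepGraph.normalizedSum, DepGraph.normalizedSum, hsd, hdiff]
  have hρ : DepGraph.rho P X = DepGraph.rho P Y := by
    rw [DepGraph.rho, DepGraph.rho]
    simp_rw [hXdef, hdiff]
  have hA3 : DepGraph.absMomentSum P Y c 3 = DepGraph.absMoment P X 3 := by
    exact_mod_cast DepGraph.absMomentSum_natCast Y c 3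
  have hA4 : DepGraph.absMomentSum P Y c 4 = DepGraph.absMoment P X 4 := by
    exact_mod_cast DepGraph.absMomentSum_natCast Y c 4
  rw [DepGraph.refinedBound, DepGraph.simpleBound, hA3, hA4, ← hW, ← hρ, ← hsd]
  rw [← hsd] at hv
  set v := DepGraph.stdDev P X with hvdef
  refine ⟨DepGraph.dKol_normalizedSum_le hX hb hL hGX hD.le hv, fun hB => ?_⟩
  have ha3 := DepGraph.absMoment_nonneg (P := P) X 3
  have ha4 : ((D : ℝ) + 1) ^ 3 * DepGraph.absMoment P X 4 / v ^ 4
      ≤ ((D : ℝ) + 1) ^ 2 * DepGraph.absMoment P X 3 / v ^ 3 * (L * ((D : ℝ) + 1) / v) := by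
    have h := DepGraph.absMoment_add_le hX hb 3 1
    rw [pow_one] at h
    calc ((D : ℝ) + 1) ^ 3 * DepGraph.absMoment P X 4 / v ^ 4
        ≤ ((D : ℝ) + 1) ^ 3 * (L * DepGraph.absMoment P X 3) / v ^ 4 := by gcongr
      _ = _ := by field_simp
  have hρκ : ∀ κ : ℝ, DepGraph.rho P X ≤ κ * ((D : ℝ) + 1) ^ 2 * DepGraph.absMoment P X 3 →
      DepGraph.rho P X / v ^ 3
        ≤ κ * (((D : ℝ) + 1) ^ 2 * DepGraph.absMoment P X 3 / v ^ 3) := by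
    intro κ h
    rw [mul_div_assoc', ← mul_assoc]
    gcongr
  refine ⟨DepGraph.refined_lt_simple (by positivity) (by positivity) ha4
    (hρκ 12 (DepGraph.rho_le_twelve_mul hX hb hGX hD.le)) (by norm_num) (by norm_num)
    (by norm_num) hB, fun hc => ?_⟩
  have h0 : ∀ k, ∫ ω, X k ω ∂P = 0 := fun k => by
    rw [hXdef, integral_sub (hYi k) (integrable_const _), hc k]
    simp
  exact DepGraph.refined_lt_simple (by positivity) (by positivity) ha4
    (hρκ 3 (DepGraph.rho_le_three_mul_of_centred hX hb hGX hD.le h0)) (by norm_num) (by norm_num)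
    (by norm_num) hB
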